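/- For a sequence $\beta=\{\beta(n)\}_{n\ge 0}$ of positive numbers let $H^2(\beta)$ be the Hilbert space of power series $f(z)=\sum_{n\ge 0}a_nz^n$ with $\|f\|^2=\sum_{n\ge 0}\beta(n)^2|a_n|^2<\infty$, so that the monomials form an orthogonal basis with $\|z^n\|=\beta(n)$. For functions $\varphi$ (mapping the open unit disk $\mathbb D$ into itself) and $G$ on $\mathbb D$ write $C_\varphi f=f\circ\varphi$ and $M_Gf=Gf$. Let $t$ be a real number and suppose that $\lim_{n\to\infty}\beta(n)/n^t=\ell$ with $0<\ell<\infty$ (then the elements of $H^2(\beta)$ converge to analytic functions on $\mathbb D$). Let $\varphi(z)=\lambda(z+u)/(1+\bar uz)$ with $|\lambda|=1$ and $|u|<1$ be an automorphism of $\mathbb D$, with inverse $\varphi^{-1}$, and let $$G(z)=(-\overline{\lambda u}\,z+1)^{2t-1},\qquad H(z)=(\bar uz+1)^{2t-1}\qquad(z\in\mathbb D),$$ with principal branches of the powers. Then $C_\varphi$, $C_{\varphi^{-1}}$, $M_G$ and $M_{1/H}$ are bounded operators on $H^2(\beta)$, and $$C_\varphi^*-M_G^*\,C_{\varphi^{-1}}\,M_{1/H}$$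 is a compact operator on $H^2(\beta)$. In particular, let $S^2(\mathbb D)$ be the space of analytic functions on $\mathbb D$ whose derivative belongs to the Hardy space $H^2$, with $\|f\|^2=|f(0)|^2+\|f'\|_{H^2}^2$; this is $H^2(\beta)$ for $\beta(0)=1$, $\beta(n)=n$ $(n\ge 1)$, which is the case $t=1$. On $S^2(\mathbb D)$ the four operators are bounded and $C_\varphi^*-M_G^*C_{\varphi^{-1}}M_{1/H}$ is compact with $G(z)=-\overline{\lambda u}\,z+1$ and $H(z)=\bar uz+1$. -/

import Mathlib

open Filter Topology Metric

noncomputable section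

/-- A sequence `β(0), β(1), β(2), …` of positive real numbers. -/
abbrev WeightSeq : Type := ℕ → {x : ℝ // 0 < x}

/-- The Taylor coefficient sequences `a` with `∑ β(n)² |a n|² < ∞`. -/
def weightedHardySubmodule (β : WeightSeq) : Submodule ℂ (ℕ → ℂ) where
  carrier := {a | Memℓp (fun n => ((β n : ℝ) : ℂ) * a n) 2}
  add_mem' := by
    intro a b ha hb
    have h := Memℓp.add ha hb
    refine (congrArg (fun s : ℕ → ℂ => Memℓp s 2) ?_).mp h
    funext n
    simp [mul_add]
  zero_mem' := by
    refine (congrArg (fun s : ℕ → ℂ => Memℓp s 2) ?_).mp (zero_memℓp (E := fun _ : ℕ => ℂ))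
    funext n
    simp
  smul_mem' := by
    intro c a ha
    have h := Memℓp.const_smul ha c
    refine (congrArg (fun s : ℕ → ℂ => Memℓp s 2) ?_).mp h
    funext n
    simp [mul_left_comm]

/-- The weighted Hardy space `H²(β)`: all power series `∑ a n zⁿ` with
`‖f‖² = ∑ β(n)² |a n|² < ∞`, an element being given by its Taylor coefficients. The
analytic function on the disk that it represents is `WeightedHardy.eval`. -/
def WeightedHardy (β : WeightSeq) : Type := weightedHardySubmodule β

namespace WeightedHardy

variable {β : WeightSeq}

instance : AddCommGroup (WeightedHardy β) :=
  inferInstanceAs (AddCommGroup (weightedHardySubmodule β))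

instance : Module ℂ (WeightedHardy β) :=
  inferInstanceAs (Module ℂ (weightedHardySubmodule β))

/-- The `n`-th Taylor coefficient. -/
def coeff (f : WeightedHardy β) (n : ℕ) : ℂ := f.1 n

theorem coeff_add (f g : WeightedHardy β) (n : ℕ) : (f + g).coeff n = f.coeff n + g.coeff n :=
  rfl

theorem coeff_smul (c : ℂ) (f : WeightedHardy β) (n : ℕ) : (c • f).coeff n = c * f.coeff n :=
  rfl

theorem coeff_injective {f g : WeightedHardy β} (h : ∀ n, f.coeff n = g.coeff n) : f = g :=
  Subtype.ext (funext h)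

/-- The identification of `H²(β)` with `ℓ²`, `∑ a n zⁿ ↦ (β(n) a n)`. -/
def toEll2 : WeightedHardy β ≃ₗ[ℂ] lp (fun _ : ℕ => ℂ) 2 where
  toFun f := ⟨fun n => ((β n : ℝ) : ℂ) * f.coeff n, f.2⟩
  invFun x := ⟨fun n => ((β n : ℝ) : ℂ)⁻¹ * x n, by
    have h := lp.memℓp x
    refine (congrArg (fun s : ℕ → ℂ => Memℓp s 2) ?_).mp h
    funext n
    have hn : ((β n : ℝ) : ℂ) ≠ 0 := by exact_mod_cast (β n).2.ne'
    simp [hn]⟩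
  map_add' f g := by
    ext n
    exact mul_add _ _ _
  map_smul' c f := by
    ext n
    simp [coeff_smul, mul_left_comm]
  left_inv f := by
    apply coeff_injective
    intro n
    have hn : ((β n : ℝ) : ℂ) ≠ 0 := by exact_mod_cast (β n).2.ne'
    change ((β n : ℝ) : ℂ)⁻¹ * (((β n : ℝ) : ℂ) * f.coeff n) = f.coeff n
    field_simp
  right_inv x := by
    ext n
    have hn : ((β n : ℝ) : ℂ) ≠ 0 := by exact_mod_cast (β n).2.ne'
    change ((β n : ℝ) : ℂ) * (((β n : ℝ) : ℂ)⁻¹ * x n) = x n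
    field_simp

theorem toEll2_apply (f : WeightedHardy β) (n : ℕ) :
    toEll2 f n = ((β n : ℝ) : ℂ) * f.coeff n := rfl

instance : NormedAddCommGroup (WeightedHardy β) :=
  NormedAddCommGroup.induced _ _ (toEll2 (β := β)) (toEll2 (β := β)).injective

instance : InnerProductSpace ℂ (WeightedHardy β) where
  inner f g := inner ℂ (toEll2 f) (toEll2 g)
  norm_smul_le c f := by
    change ‖toEll2 (c • f)‖ ≤ ‖c‖ * ‖toEll2 f‖
    rw [map_smul, norm_smul]
  norm_sq_eq_re_inner f := by
    change ‖toEll2 f‖ ^ 2 = _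
    exact norm_sq_eq_re_inner (𝕜 := ℂ) (toEll2 f)
  conj_inner_symm f g := inner_conj_symm _ _
  add_left f g h := by rw [map_add, inner_add_left]
  smul_left f g c := by rw [map_smul, inner_smul_left]

/-- `⟪f, g⟫ = ∑ β(n)² conj (a n) (b n)` (linear in the second variable, as in Mathlib). -/
theorem hasSum_inner (f g : WeightedHardy β) :
    HasSum (fun n => ((β n : ℝ) : ℂ) ^ 2 * (starRingEnd ℂ (f.coeff n) * g.coeff n))
      (inner ℂ f g) := by
  have h := lp.hasSum_inner (𝕜 := ℂ) (toEll2 f) (toEll2 g)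
  refine (congrArg (fun s : ℕ → ℂ => HasSum s (inner ℂ (toEll2 f) (toEll2 g))) ?_).mp h
  funext n
  simp only [toEll2_apply, RCLike.inner_apply, map_mul, Complex.conj_ofReal]
  ring

instance : CompleteSpace (WeightedHardy β) := by
  let e : WeightedHardy β ≃ₗᵢ[ℂ] lp (fun _ : ℕ => ℂ) 2 := ⟨toEll2, fun _ => rfl⟩
  exact (completeSpace_congr (e := e.toEquiv) e.isometry.isUniformEmbedding).mpr inferInstance

/-- The function `z ↦ ∑ a n zⁿ` that an element of `H²(β)` represents. -/
def eval (f : WeightedHardy β) (z : ℂ) : ℂ := ∑' n, f.coeff n * z ^ n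

/-- If `β(n) / n^t` tends to a positive limit, the series defining `eval` converges on the
open unit disk. -/
theorem hasSum_eval {t ℓ : ℝ} (hℓ : 0 < ℓ)
    (hβ : Tendsto (fun n : ℕ => (β n : ℝ) / (n : ℝ) ^ t) atTop (𝓝 ℓ))
    (f : WeightedHardy β) {z : ℂ} (hz : z ∈ ball (0 : ℂ) 1) :
    HasSum (fun n => f.coeff n * z ^ n) (f.eval z) := by
  apply Summable.hasSum
  have hz1 : ‖z‖ < 1 := by simpa using hz
  obtain ⟨k, hk⟩ := exists_nat_ge (-t)
  have hs := (summable_pow_mul_geometric_of_norm_lt_one k hz1).norm.mul_left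
    (2 * ‖toEll2 f‖ / ℓ)
  refine hs.of_norm_bounded_eventually_nat ?_
  filter_upwards [hβ.eventually_const_lt (half_lt_self hℓ), eventually_ge_atTop 1] with n hn h1
  have hn1 : (1 : ℝ) ≤ n := by exact_mod_cast h1
  have hpos : (0 : ℝ) < (n : ℝ) ^ t := Real.rpow_pos_of_pos (by linarith) t
  rw [lt_div_iff₀ hpos] at hn
  have hM : (β n : ℝ) * ‖f.coeff n‖ ≤ ‖toEll2 f‖ := by
    have h := lp.norm_apply_le_norm (p := 2) (by norm_num) (toEll2 f) n
    rw [toEll2_apply, norm_mul, Complex.norm_real, Real.norm_of_nonneg (β n).2.le] at h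
    exact h
  have hk1 : (1 : ℝ) ≤ (n : ℝ) ^ t * (n : ℝ) ^ k := by
    rw [← Real.rpow_natCast, ← Real.rpow_add (by linarith)]
    exact Real.one_le_rpow hn1 (by linarith)
  have hc : ‖f.coeff n‖ ≤ 2 * ‖toEll2 f‖ / ℓ * (n : ℝ) ^ k := by
    have h2 : ℓ / 2 * (n : ℝ) ^ t * ‖f.coeff n‖ ≤ ‖toEll2 f‖ :=
      (mul_le_mul_of_nonneg_right hn.le (norm_nonneg _)).trans hM
    have h3 : ‖f.coeff n‖ ≤ (n : ℝ) ^ t * (n : ℝ) ^ k * ‖f.coeff n‖ :=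
      le_mul_of_one_le_left (norm_nonneg _) hk1
    have h4 := mul_le_mul_of_nonneg_right h2 (by positivity : (0 : ℝ) ≤ (n : ℝ) ^ k)
    rw [div_mul_eq_mul_div, le_div_iff₀ hℓ]
    nlinarith
  rw [norm_mul, norm_pow, norm_mul, norm_pow, norm_pow, ← mul_assoc]
  refine mul_le_mul_of_nonneg_right ?_ (by positivity)
  simpa using hc

/-- `T` is the bounded composition operator `C_φ f = f ∘ φ` on `H²(β)`. -/
def IsCompositionOperator (φ : ℂ → ℂ) (T : WeightedHardy β →L[ℂ] WeightedHardy β) : Prop :=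
  ∀ f, ∀ z ∈ ball (0 : ℂ) 1, (T f).eval z = f.eval (φ z)

/-- `T` is the bounded multiplication operator `M_G f = G f` on `H²(β)`. -/
def IsMultiplicationOperator (G : ℂ → ℂ) (T : WeightedHardy β →L[ℂ] WeightedHardy β) : Prop :=
  ∀ f, ∀ z ∈ ball (0 : ℂ) 1, (T f).eval z = G z * f.eval z

end WeightedHardy

/-- On `H²(β)` the operators `C_φ`, `C_ψ`, `M_G`, `M_F` exist as bounded operators, and
`C_φ^* = M_G^* C_ψ M_F` modulo compact operators. -/
def AdjointFormulaModCompact (β : WeightSeq) (φ ψ G F : ℂ → ℂ) : Prop :=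
  (∃ T : WeightedHardy β →L[ℂ] WeightedHardy β, WeightedHardy.IsCompositionOperator φ T) ∧
  (∃ T : WeightedHardy β →L[ℂ] WeightedHardy β, WeightedHardy.IsCompositionOperator ψ T) ∧
  (∃ T : WeightedHardy β →L[ℂ] WeightedHardy β, WeightedHardy.IsMultiplicationOperator G T) ∧
  (∃ T : WeightedHardy β →L[ℂ] WeightedHardy β, WeightedHardy.IsMultiplicationOperator F T) ∧
  ∀ Cφ Cψ MG MF : WeightedHardy β →L[ℂ] WeightedHardy β,
    WeightedHardy.IsCompositionOperator φ Cφ → WeightedHardy.IsCompositionOperator ψ Cψ →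
    WeightedHardy.IsMultiplicationOperator G MG → WeightedHardy.IsMultiplicationOperator F MF →
    IsCompactOperator (ContinuousLinearMap.adjoint Cφ -
      (ContinuousLinearMap.adjoint MG).comp (Cψ.comp MF))

/-- The disk automorphism `φ(z) = lam (z + u) / (1 + ū z)`. -/
def diskAut (lam u : ℂ) (z : ℂ) : ℂ := lam * (z + u) / (1 + starRingEnd ℂ u * z)

/-- The inverse of `diskAut lam u` as a map of the open unit disk. -/
def diskAutInv (lam u : ℂ) : ℂ → ℂ := Function.invFunOn (diskAut lam u) (ball 0 1)

/-- The weights `β(0) = 1`, `β(n) = n` for `n ≥ 1`. With them `‖f‖² = |f(0)|² + ‖f'‖²`, where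
the last norm is that of the Hardy space `H²`. -/
def s2Weight : WeightSeq := fun n => ⟨if n = 0 then 1 else n, by
  split_ifs with h
  · exact one_pos
  · exact_mod_cast Nat.pos_of_ne_zero h⟩

/-- The space `S²` of the analytic functions on the disk with derivative in `H²` is `H²(β)` for
these weights: `a` is in it if and only if the coefficients `(n + 1) a (n + 1)` of the derivative
are square summable. -/
theorem mem_s2Weight_iff (a : ℕ → ℂ) :
    a ∈ weightedHardySubmodule s2Weight ↔
      Summable (fun n : ℕ => ‖((n : ℂ) + 1) * a (n + 1)‖ ^ 2) := by
  change Memℓp _ 2 ↔ _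
  rw [memℓp_gen_iff (by norm_num), ← summable_nat_add_iff 1]
  refine summable_congr fun n => ?_
  simp [s2Weight]

end

noncomputable section

/-! For small t there is an equivalent space on which the formula holds exactly. If t < 1/2, put s =
1 - 2t > 0 and take the space with reproducing kernel K_w(z) = (1 - conj w z)^(-s). Euler's limit
for the Gamma function shows that its weights grow like n^t. There C_φ^* K_w = K_{φ(w)}, M_G^* K_v =
conj(G(v)) K_v, and the transformation law of 1 - conj w z under φ shows that C_{φ⁻¹} M_{1/H} K_w is
K_{φ(w)} / conj(G(φ(w))). So both sides agree on all kernels, whose span is dense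
(`hasAdjointFormula_negBinomial`).

Two transfers, both modulo compact operators, give the general case. Two weights of the same order
define the same power series with equivalent norms, and the adjoint of the identity map between them
is asymptotically a scalar multiple of its inverse. Conjugation by it therefore preserves the
formula (`HasOrder.hasAdjointFormula_of_hasOrder`).

To raise t by 1, differentiate. With suitable weights of order t - 1 on the target, D D^* = 1, and 1
- D^* D is the projection onto constants. The chain rule turns C_φ into φ' C_φ, and φ' is a constant
times the square of -conj(λu) φ + 1, which accounts for the change of exponent from 2t - 3 to 2t -
1. The product rule makes D commute with M_G and M_{1/H} up to a multiplication followed by the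
inclusion into the larger space, which is compact (`HasOrder.hasAdjointFormula_of_derivWeight`).
Induction on the number of derivatives then reaches every real t. -/

theorem isCompactOperator_of_tendsto_norm_sub {E F : Type*} [NormedAddCommGroup E]
    [NormedSpace ℂ E] [NormedAddCommGroup F] [NormedSpace ℂ F] [CompleteSpace F] {T : E →L[ℂ] F}
    (R : ℕ → E →L[ℂ] F) (hR : ∀ n, IsCompactOperator (R n))
    (h : Tendsto (fun n => ‖T - R n‖) atTop (𝓝 0)) : IsCompactOperator T := by
  simp_rw [norm_sub_rev T] at h
  exact isCompactOperator_of_tendsto (tendsto_iff_norm_sub_tendsto_zero.2 h)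
    (Eventually.of_forall hR)

namespace WeightedHardy

variable {β β' : WeightSeq}

/-! ### Operators given by substitutions of Taylor coefficients -/

/-- As τ is injective on the support of c, each coefficient of f is used at most once, so the sum is
bounded by C² times a partial sum of ‖f‖². -/
theorem sum_norm_sq_le_of_pull {c : ℕ → ℂ} {τ : ℕ → ℕ} {C : ℝ}
    (hτ : ∀ n m, c n ≠ 0 → c m ≠ 0 → τ n = τ m → n = m)
    (hC : ∀ n, (β' n : ℝ) * ‖c n‖ ≤ C * (β (τ n) : ℝ)) (f : WeightedHardy β) (s : Finset ℕ) :
    ∑ n ∈ s, ‖((β' n : ℝ) : ℂ) * (c n * f.coeff (τ n))‖ ^ (2 : ENNReal).toReal ≤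
      (C * ‖f‖) ^ (2 : ENNReal).toReal := by
  have h2 : (2 : ENNReal).toReal = ((2 : ℕ) : ℝ) := by norm_num
  have hs := lp.sum_rpow_le_norm_rpow (p := 2) (by norm_num) (toEll2 f)
    ((s.filter fun n => c n ≠ 0).image τ)
  simp only [h2, Real.rpow_natCast] at hs ⊢
  rw [Finset.sum_image (fun n hn m hm h =>
    hτ n m (Finset.mem_filter.1 hn).2 (Finset.mem_filter.1 hm).2 h)] at hs
  calc _ = ∑ n ∈ s.filter (fun n => c n ≠ 0),
        ‖((β' n : ℝ) : ℂ) * (c n * f.coeff (τ n))‖ ^ 2 := by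
        refine (Finset.sum_subset (Finset.filter_subset _ _) fun n hn h => ?_).symm
        have : c n = 0 := by simpa [hn] using h
        simp [this]
    _ ≤ ∑ n ∈ s.filter (fun n => c n ≠ 0), C ^ 2 * ‖toEll2 f (τ n)‖ ^ 2 := by
        refine Finset.sum_le_sum fun n _ => ?_
        rw [toEll2_apply, ← mul_pow]
        refine pow_le_pow_left₀ (norm_nonneg _) ?_ 2
        rw [norm_mul, norm_mul, norm_mul, Complex.norm_real, Complex.norm_real,
          Real.norm_of_nonneg (β' n).2.le, Real.norm_of_nonneg (β (τ n)).2.le, ← mul_assoc,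
          ← mul_assoc]
        exact mul_le_mul_of_nonneg_right (hC n) (norm_nonneg _)
    _ ≤ (C * ‖f‖) ^ 2 := by
        rw [← Finset.mul_sum, mul_pow]
        exact mul_le_mul_of_nonneg_left hs (sq_nonneg C)

/-- The operator sending the coefficient sequence `a` to `n ↦ c n * a (τ n)`. -/
theorem exists_pull {c : ℕ → ℂ} {τ : ℕ → ℕ} {C : ℝ} (hC0 : 0 ≤ C)
    (hτ : ∀ n m, c n ≠ 0 → c m ≠ 0 → τ n = τ m → n = m)
    (hC : ∀ n, (β' n : ℝ) * ‖c n‖ ≤ C * (β (τ n) : ℝ)) :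
    ∃ T : WeightedHardy β →L[ℂ] WeightedHardy β',
      (∀ f n, (T f).coeff n = c n * f.coeff (τ n)) ∧ ‖T‖ ≤ C := by
  let L : WeightedHardy β →ₗ[ℂ] WeightedHardy β' :=
    { toFun := fun f => ⟨fun n => c n * f.coeff (τ n),
        memℓp_gen' (sum_norm_sq_le_of_pull hτ hC f)⟩
      map_add' := fun f g => coeff_injective fun n => mul_add _ _ _
      map_smul' := fun a f => coeff_injective fun n => mul_left_comm _ _ _ }
  have hL : ∀ f, ‖L f‖ ≤ C * ‖f‖ := fun f =>
    lp.norm_le_of_forall_sum_le (p := 2) (by norm_num) (by positivity) (f := toEll2 (L f))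
      (sum_norm_sq_le_of_pull hτ hC f)
  exact ⟨L.mkContinuous C hL, fun f n => rfl, L.mkContinuous_norm_le hC0 hL⟩

theorem exists_diagonal {c : ℕ → ℂ} {C : ℝ} (hC : ∀ n, (β' n : ℝ) * ‖c n‖ ≤ C * (β n : ℝ)) :
    ∃ T : WeightedHardy β →L[ℂ] WeightedHardy β',
      (∀ f n, (T f).coeff n = c n * f.coeff n) ∧ ‖T‖ ≤ C :=
  exists_pull (τ := id) (by
    by_contra! h
    nlinarith [hC 0, mul_nonneg (β' 0).2.le (norm_nonneg (c 0)), (β 0).2])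
    (fun _ _ _ _ h => h) hC

theorem ext_coeff {S T : WeightedHardy β →L[ℂ] WeightedHardy β'}
    (h : ∀ f n, (S f).coeff n = (T f).coeff n) : S = T :=
  ContinuousLinearMap.ext fun f => coeff_injective (h f)

theorem coeff_sub (f g : WeightedHardy β) (n : ℕ) : (f - g).coeff n = f.coeff n - g.coeff n :=
  rfl

/-- Such an operator has finite rank; the induction splits off one rank-one diagonal entry at a
time. -/
theorem isCompactOperator_of_coeff_eq_zero {T : WeightedHardy β →L[ℂ] WeightedHardy β'} (N : ℕ)
    {c : ℕ → ℂ} (hT : ∀ f n, (T f).coeff n = c n * f.coeff n) (hN : ∀ n, N ≤ n → c n = 0) :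
    IsCompactOperator T := by
  induction N generalizing T c with
  | zero =>
    have : T = 0 := ext_coeff fun f n => by rw [hT, hN n (Nat.zero_le n), zero_mul]; rfl
    rw [this]
    exact isCompactOperator_zero
  | succ N ih =>
    let p : WeightedHardy β →L[ℂ] ℂ :=
      LinearMap.mkContinuous
        { toFun := fun f => f.coeff N, map_add' := fun _ _ => rfl, map_smul' := fun _ _ => rfl }
        (β N : ℝ)⁻¹ fun f => by
          have h := lp.norm_apply_le_norm (p := 2) (by norm_num) (toEll2 f) N
          rw [toEll2_apply, norm_mul, Complex.norm_real, Real.norm_of_nonneg (β N).2.le] at h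
          rw [inv_mul_eq_div, le_div_iff₀ (β N).2, mul_comm]
          exact h
    obtain ⟨R, hR, -⟩ := exists_diagonal (β := β) (β' := β')
      (c := fun n => if n = N then c n else 0) (C := (β' N : ℝ) * ‖c N‖ / β N) (fun n => by
        split_ifs with h
        · subst h
          rw [div_mul_cancel₀ _ (β n).2.ne']
        · rw [norm_zero, mul_zero]
          have := (β n).2
          have := (β' N).2
          have := (β N).2
          positivity)
    let e : WeightedHardy β' :=
      ⟨Pi.single N (c N), by
        refine memℓp_gen (summable_of_ne_finset_zero (s := {N}) fun n hn => ?_)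
        have : n ≠ N := by simpa using hn
        simp [this]⟩
    have hRe : ∀ f, R f = p f • e := fun f => coeff_injective fun n => by
      rw [hR, coeff_smul]
      change _ = f.coeff N * (Pi.single N (c N) : ℕ → ℂ) n
      split_ifs with h
      · subst h
        rw [Pi.single_eq_same, mul_comm]
      · rw [Pi.single_eq_of_ne h, zero_mul, mul_zero]
    have hRc : IsCompactOperator R := by
      have : R = (ContinuousLinearMap.toSpanSingleton ℂ e).comp p :=
        ContinuousLinearMap.ext fun f => by rw [hRe]; simp
      rw [this]
      exact (isCompactOperator_of_locallyCompactSpace_rng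
        (ContinuousLinearMap.toSpanSingleton ℂ e)).comp_clm p
    have hd : IsCompactOperator (T - R) := by
      refine ih (c := fun n => if n = N then 0 else c n) (fun f n => ?_) fun n hn => ?_
      · rw [sub_apply, coeff_sub, hT, hR]
        split_ifs <;> simp
      · split_ifs with h
        · rfl
        · exact hN n (by omega)
    have := hd.add hRc
    rwa [← FunLike.coe_add, sub_add_cancel] at this

/-- Between weighted spaces the effective size of the n-th entry is |c n| β'(n)/β(n). When this
tends to 0, the finite truncations converge in operator norm. -/
theorem isCompactOperator_of_diagonal {T : WeightedHardy β →L[ℂ] WeightedHardy β'}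
    {c : ℕ → ℂ} (hT : ∀ f n, (T f).coeff n = c n * f.coeff n)
    (hc : Tendsto (fun n => ‖c n‖ * ((β' n : ℝ) / β n)) atTop (𝓝 0)) :
    IsCompactOperator T := by
  have key : ∀ ε : ℝ, 0 < ε → ∃ R : WeightedHardy β →L[ℂ] WeightedHardy β',
      IsCompactOperator R ∧ ‖T - R‖ ≤ ε := by
    intro ε hε
    obtain ⟨N, hN⟩ := eventually_atTop.1 (hc.eventually_le_const hε)
    obtain ⟨R, hR, hRn⟩ := exists_diagonal (β := β) (β' := β')
      (c := fun n => if n < N then 0 else c n) (C := ε) (fun n => by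
        have h1 := (β n).2
        have h2 := (β' n).2
        split_ifs with h
        · rw [norm_zero, mul_zero]
          positivity
        · have := hN n (not_lt.1 h)
          rw [← mul_div_assoc, div_le_iff₀ h1] at this
          linarith)
    refine ⟨T - R, ?_, by rwa [sub_sub_cancel]⟩
    refine isCompactOperator_of_coeff_eq_zero N (c := fun n => if n < N then c n else 0)
      (fun f n => ?_) fun n hn => if_neg (not_lt.2 hn)
    rw [sub_apply, coeff_sub, hT, hR]
    split_ifs <;> simp
  choose R hRc hRn using fun n : ℕ => key (1 / ((n : ℝ) + 1)) (by positivity)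
  have h : Tendsto (fun n => ‖T - R n‖) atTop (𝓝 0) :=
    squeeze_zero (fun n => norm_nonneg (T - R n)) hRn tendsto_one_div_add_atTop_nhds_zero_nat
  exact isCompactOperator_of_tendsto_norm_sub R hRc h

/-- The adjoint of a diagonal operator. -/
theorem adjoint_diagonal {T : WeightedHardy β →L[ℂ] WeightedHardy β'}
    {c : ℕ → ℂ} (hT : ∀ f n, (T f).coeff n = c n * f.coeff n) (f : WeightedHardy β') (n : ℕ) :
    (ContinuousLinearMap.adjoint T f).coeff n =
      (((β' n : ℝ) : ℂ) / ((β n : ℝ) : ℂ)) ^ 2 * starRingEnd ℂ (c n) * f.coeff n := by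
  have hb : ((β n : ℝ) : ℂ) ≠ 0 := by exact_mod_cast (β n).2.ne'
  let e : WeightedHardy β :=
    ⟨Pi.single n 1, by
      refine memℓp_gen (summable_of_ne_finset_zero (s := {n}) fun m hm => ?_)
      have : m ≠ n := by simpa using hm
      simp [this]⟩
  have he : ∀ m, m ≠ n → e.coeff m = 0 := fun m hm => Pi.single_eq_of_ne hm _
  have he' : e.coeff n = 1 := Pi.single_eq_same _ _
  have h1 := (hasSum_inner e (ContinuousLinearMap.adjoint T f)).unique
    (hasSum_single n fun m hm => by rw [he m hm]; simp)
  have h2 := (hasSum_inner (T e) f).unique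
    (hasSum_single n fun m hm => by rw [hT, he m hm]; simp)
  rw [ContinuousLinearMap.adjoint_inner_right, h2, hT, he'] at h1
  simp only [mul_one, map_one, one_mul] at h1
  field_simp
  linear_combination -h1

end WeightedHardy

/-! ### Growth order of weights -/

theorem tendsto_natCast_div_succ_rpow (p : ℝ) :
    Tendsto (fun n : ℕ => ((n : ℝ) / ((n : ℝ) + 1)) ^ p) atTop (𝓝 1) := by
  have h := (tendsto_natCast_div_add_atTop (1 : ℝ)).rpow_const (p := p) (Or.inl one_ne_zero)
  rwa [Real.one_rpow] at h

theorem summable_succ_rpow_mul_geometric (p : ℝ) {r : ℝ} (h0 : 0 ≤ r) (h1 : r < 1) :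
    Summable fun n : ℕ => ((n : ℝ) + 1) ^ p * r ^ n := by
  obtain ⟨k, hk⟩ := exists_nat_ge p
  have hs := (summable_pow_mul_geometric_of_norm_lt_one k
    (by rwa [Real.norm_of_nonneg h0] : ‖r‖ < 1)).mul_left (2 ^ k)
  refine hs.of_norm_bounded_eventually_nat ?_
  filter_upwards [eventually_ge_atTop 1] with n hn
  have hn1 : (1 : ℝ) ≤ n := by exact_mod_cast hn
  rw [Real.norm_of_nonneg (by positivity), ← mul_assoc, ← mul_pow]
  refine mul_le_mul_of_nonneg_right ?_ (by positivity)
  calc ((n : ℝ) + 1) ^ p ≤ ((n : ℝ) + 1) ^ (k : ℝ) :=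
        Real.rpow_le_rpow_of_exponent_le (by linarith) hk
    _ = ((n : ℝ) + 1) ^ k := Real.rpow_natCast _ _
    _ ≤ (2 * n) ^ k := pow_le_pow_left₀ (by linarith) (by linarith) k

namespace WeightedHardy

variable {β β' β'' : WeightSeq}

/-- The weights grow like a positive multiple of `n ^ t`. -/
def HasOrder (β : WeightSeq) (t : ℝ) : Prop :=
  ∃ ℓ : ℝ, 0 < ℓ ∧ Tendsto (fun n : ℕ => (β n : ℝ) / (n : ℝ) ^ t) atTop (𝓝 ℓ)

/-- Passing from n to n + 1 removes the degenerate power at n = 0, so that limits yield bounds valid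
for every index. -/
theorem HasOrder.tendsto_div_succ {t : ℝ} (h : HasOrder β t) :
    ∃ ℓ : ℝ, 0 < ℓ ∧ Tendsto (fun n : ℕ => (β n : ℝ) / ((n : ℝ) + 1) ^ t) atTop (𝓝 ℓ) := by
  obtain ⟨ℓ, hℓ, h⟩ := h
  refine ⟨ℓ, hℓ, ?_⟩
  have := h.mul (tendsto_natCast_div_succ_rpow t)
  rw [mul_one] at this
  refine this.congr' ?_
  filter_upwards [eventually_ge_atTop 1] with n hn
  have hn1 : (0 : ℝ) < n := by exact_mod_cast hn
  have : (0 : ℝ) < (n : ℝ) ^ t := Real.rpow_pos_of_pos hn1 t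
  rw [Real.div_rpow hn1.le (by positivity)]
  field_simp

theorem HasOrder.exists_bounds {t : ℝ} (h : HasOrder β t) :
    ∃ C : ℝ, 0 < C ∧ ∀ n, (β n : ℝ) ≤ C * ((n : ℝ) + 1) ^ t ∧
      ((n : ℝ) + 1) ^ t ≤ C * (β n : ℝ) := by
  obtain ⟨ℓ, hℓ, h⟩ := h.tendsto_div_succ
  obtain ⟨A, hA⟩ := h.bddAbove_range
  obtain ⟨B, hB⟩ := (h.inv₀ hℓ.ne').bddAbove_range
  have hp : ∀ n : ℕ, (0 : ℝ) < ((n : ℝ) + 1) ^ t := fun n => by positivity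
  refine ⟨max 1 (max A B), by positivity, fun n => ⟨?_, ?_⟩⟩
  · have := hA (Set.mem_range_self n)
    rw [← div_le_iff₀ (hp n)]
    exact this.trans ((le_max_left A B).trans (le_max_right _ _))
  · have := hB (Set.mem_range_self n)
    simp only [inv_div] at this
    rw [← div_le_iff₀ (β n).2]
    exact this.trans ((le_max_right A B).trans (le_max_right _ _))

theorem HasOrder.tendsto_div {t : ℝ} (h : HasOrder β t) (h' : HasOrder β' t) :
    ∃ c : ℝ, 0 < c ∧ Tendsto (fun n => (β' n : ℝ) / β n) atTop (𝓝 c) := by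
  obtain ⟨ℓ, hℓ, h⟩ := h.tendsto_div_succ
  obtain ⟨ℓ', hℓ', h'⟩ := h'.tendsto_div_succ
  refine ⟨ℓ' / ℓ, by positivity, (h'.div h hℓ.ne').congr fun n => ?_⟩
  have : (0 : ℝ) < ((n : ℝ) + 1) ^ t := by positivity
  have := (β n).2
  simp only [Pi.div_apply]
  field_simp

theorem HasOrder.tendsto_div_zero {t : ℝ} (h : HasOrder β t) (h' : HasOrder β' (t - 1)) :
    Tendsto (fun n => (β' n : ℝ) / β n) atTop (𝓝 0) := by
  obtain ⟨ℓ, hℓ, h⟩ := h.tendsto_div_succ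
  obtain ⟨ℓ', hℓ', h'⟩ := h'.tendsto_div_succ
  have := (h'.div h hℓ.ne').mul (tendsto_one_div_add_atTop_nhds_zero_nat (𝕜 := ℝ))
  rw [mul_zero] at this
  refine this.congr fun n => ?_
  have h0 : (0 : ℝ) < ((n : ℝ) + 1) ^ t := by positivity
  have := (β n).2
  simp only [Pi.div_apply]
  rw [Real.rpow_sub_one (by positivity)]
  field_simp

/-- The weights for which differentiation is a coisometry from `H²(β)`. -/
def derivWeight (β : WeightSeq) : WeightSeq := fun n =>
  ⟨(β (n + 1) : ℝ) / ((n : ℝ) + 1), div_pos (β (n + 1)).2 (by positivity)⟩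

theorem derivWeight_apply (β : WeightSeq) (n : ℕ) :
    (derivWeight β n : ℝ) = (β (n + 1) : ℝ) / ((n : ℝ) + 1) := rfl

theorem HasOrder.hasOrder_derivWeight {t : ℝ} (h : HasOrder β t) :
    HasOrder (derivWeight β) (t - 1) := by
  obtain ⟨ℓ, hℓ, h⟩ := h
  refine ⟨ℓ, hℓ, ?_⟩
  have := ((tendsto_add_atTop_iff_nat 1).2 h).mul (tendsto_natCast_div_succ_rpow (1 - t))
  rw [mul_one] at this
  refine this.congr' ?_
  filter_upwards [eventually_ge_atTop 1] with n hn
  have hn1 : (0 : ℝ) < n := by exact_mod_cast hn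
  have h0 : (0 : ℝ) < (n : ℝ) ^ t := Real.rpow_pos_of_pos hn1 t
  have h2 : (0 : ℝ) < ((n : ℝ) + 1) ^ t := by positivity
  rw [Real.div_rpow hn1.le (by positivity), derivWeight_apply, Real.rpow_sub_one hn1.ne',
    Real.rpow_sub hn1, Real.rpow_sub (by positivity), Real.rpow_one, Real.rpow_one]
  push_cast
  field_simp

/-! ### Evaluation -/

theorem HasOrder.hasSum_eval {t : ℝ} (h : HasOrder β t) (f : WeightedHardy β) {z : ℂ}
    (hz : z ∈ ball (0 : ℂ) 1) : HasSum (fun n => f.coeff n * z ^ n) (f.eval z) := by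
  obtain ⟨ℓ, hℓ, h⟩ := h
  exact WeightedHardy.hasSum_eval hℓ h f hz

/-- The reproducing kernel. Its coefficients give a finite norm because 1/β(n) grows at most
polynomially while |w|^n decays geometrically. Being an inner product, evaluation is then linear and
continuous. -/
theorem HasOrder.exists_kernel {t : ℝ} (h : HasOrder β t) {w : ℂ} (hw : w ∈ ball (0 : ℂ) 1) :
    ∃ k : WeightedHardy β,
      (∀ n, k.coeff n = starRingEnd ℂ w ^ n / ((β n : ℝ) : ℂ) ^ 2) ∧
      ∀ f, inner ℂ k f = f.eval w := by
  obtain ⟨C, hC, hb⟩ := h.exists_bounds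
  have hw1 : ‖w‖ < 1 := by simpa using hw
  have hbn : ∀ n, ((β n : ℝ) : ℂ) ≠ 0 := fun n => by exact_mod_cast (β n).2.ne'
  have hmem : Memℓp (fun n => ((β n : ℝ) : ℂ) *
      (starRingEnd ℂ w ^ n / ((β n : ℝ) : ℂ) ^ 2)) 2 := by
    refine memℓp_gen ?_
    have hs := (summable_succ_rpow_mul_geometric (-(2 * t)) (sq_nonneg ‖w‖)
      (by nlinarith [norm_nonneg w])).mul_left (C ^ 2)
    refine hs.of_nonneg_of_le (fun n => by positivity) fun n => ?_
    have h2 : (2 : ENNReal).toReal = ((2 : ℕ) : ℝ) := by norm_num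
    have hp : (0 : ℝ) < ((n : ℝ) + 1) ^ t := by positivity
    have hβ := (β n).2
    have heq : ‖((β n : ℝ) : ℂ) * (starRingEnd ℂ w ^ n / ((β n : ℝ) : ℂ) ^ 2)‖ =
        ‖w‖ ^ n / (β n : ℝ) := by
      rw [norm_mul, norm_div, norm_pow, norm_pow, Complex.norm_real, Complex.norm_conj,
        Real.norm_of_nonneg hβ.le]
      field_simp
    rw [h2, Real.rpow_natCast, heq, Real.rpow_neg (by positivity), mul_comm 2 t,
      Real.rpow_mul (by positivity), Real.rpow_two, div_pow, ← pow_mul, ← pow_mul, mul_comm n 2,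
      ← mul_assoc, div_eq_inv_mul]
    refine mul_le_mul_of_nonneg_right ?_ (by positivity)
    rw [← div_eq_mul_inv, inv_eq_one_div, div_le_div_iff₀ (by positivity) (by positivity),
      one_mul, ← mul_pow]
    exact pow_le_pow_left₀ hp.le (hb n).2 2
  refine ⟨⟨_, hmem⟩, fun n => rfl, fun f => (hasSum_inner _ f).unique ?_⟩
  refine (h.hasSum_eval f hw).congr_fun ?_
  intro n
  have := hbn n
  change ((β n : ℝ) : ℂ) ^ 2 * (starRingEnd ℂ (starRingEnd ℂ w ^ n / ((β n : ℝ) : ℂ) ^ 2) *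
    f.coeff n) = _
  rw [map_div₀, map_pow, map_pow, Complex.conj_conj, Complex.conj_ofReal]
  field_simp

theorem hasFPowerSeriesOnBall_of_hasSum {a : ℕ → ℂ} {F : ℂ → ℂ}
    (h : ∀ z ∈ ball (0 : ℂ) 1, HasSum (fun n => a n * z ^ n) (F z)) :
    HasFPowerSeriesOnBall F (FormalMultilinearSeries.ofScalars ℂ a) 0 1 where
  r_le := by
    refine ENNReal.le_of_forall_nnreal_lt fun r hr => ?_
    have hr1 : (r : ℝ) < 1 := by exact_mod_cast hr
    refine FormalMultilinearSeries.le_radius_of_summable_norm _ ?_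
    have := (h (r : ℝ) (by simpa using hr1)).summable.norm
    refine this.congr fun n => ?_
    simp
  r_pos := one_pos
  hasSum := by
    intro y hy
    have hy1 : y ∈ ball (0 : ℂ) 1 := by
      rwa [← ENNReal.ofReal_one, Metric.eball_ofReal] at hy
    have := h y hy1
    simpa [FormalMultilinearSeries.ofScalars_apply_eq, mul_comm] using this

theorem HasOrder.hasFPowerSeriesOnBall_eval {t : ℝ} (h : HasOrder β t) (f : WeightedHardy β) :
    HasFPowerSeriesOnBall f.eval (FormalMultilinearSeries.ofScalars ℂ f.coeff) 0 1 :=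
  hasFPowerSeriesOnBall_of_hasSum fun _ hz => h.hasSum_eval f hz

theorem HasOrder.ext_eval {t : ℝ} (h : HasOrder β t) {f g : WeightedHardy β}
    (hfg : ∀ z ∈ ball (0 : ℂ) 1, f.eval z = g.eval z) : f = g := by
  have := HasFPowerSeriesAt.eq_formalMultilinearSeries_of_eventually
    (h.hasFPowerSeriesOnBall_eval f).hasFPowerSeriesAt
    (h.hasFPowerSeriesOnBall_eval g).hasFPowerSeriesAt
    (Filter.eventually_of_mem (ball_mem_nhds 0 one_pos) hfg)
  exact coeff_injective (congrFun (FormalMultilinearSeries.ofScalars_series_injective ℂ ℂ this))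

theorem HasOrder.eval_add {t : ℝ} (h : HasOrder β t) (f g : WeightedHardy β) {z : ℂ}
    (hz : z ∈ ball (0 : ℂ) 1) : (f + g).eval z = f.eval z + g.eval z := by
  obtain ⟨k, -, hk⟩ := h.exists_kernel hz
  rw [← hk, ← hk, ← hk, inner_add_right]

theorem HasOrder.eval_smul {t : ℝ} (h : HasOrder β t) (c : ℂ) (f : WeightedHardy β) {z : ℂ}
    (hz : z ∈ ball (0 : ℂ) 1) : (c • f).eval z = c * f.eval z := by
  obtain ⟨k, -, hk⟩ := h.exists_kernel hz
  rw [← hk, ← hk, inner_smul_right]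

/-! ### Weighted composition operators -/

/-- `T` is the weighted composition operator `f ↦ w · (f ∘ φ)` from `H²(β)` to `H²(β')`. -/
def IsWeightedComposition (w φ : ℂ → ℂ) (T : WeightedHardy β →L[ℂ] WeightedHardy β') : Prop :=
  ∀ f, ∀ z ∈ ball (0 : ℂ) 1, (T f).eval z = w z * f.eval (φ z)

theorem IsWeightedComposition.congr {w φ w' φ' : ℂ → ℂ}
    {T : WeightedHardy β →L[ℂ] WeightedHardy β'} (hT : IsWeightedComposition w φ T)
    (hw : ∀ z ∈ ball (0 : ℂ) 1, w z = w' z) (hφ : ∀ z ∈ ball (0 : ℂ) 1, φ z = φ' z) :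
    IsWeightedComposition w' φ' T := fun f z hz => by rw [hT f z hz, hw z hz, hφ z hz]

theorem IsWeightedComposition.comp {w φ w' φ' : ℂ → ℂ}
    {T : WeightedHardy β' →L[ℂ] WeightedHardy β''} {S : WeightedHardy β →L[ℂ] WeightedHardy β'}
    (hT : IsWeightedComposition w φ T) (hS : IsWeightedComposition w' φ' S)
    (hφ : ∀ z ∈ ball (0 : ℂ) 1, φ z ∈ ball (0 : ℂ) 1) :
    IsWeightedComposition (fun z => w z * w' (φ z)) (fun z => φ' (φ z)) (T.comp S) :=
  fun f z hz => by
    rw [ContinuousLinearMap.comp_apply, hT _ z hz, hS _ _ (hφ z hz), mul_assoc]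

theorem IsWeightedComposition.const_smul {t : ℝ} (h : HasOrder β' t) {w φ : ℂ → ℂ}
    {T : WeightedHardy β →L[ℂ] WeightedHardy β'} (hT : IsWeightedComposition w φ T) (c : ℂ) :
    IsWeightedComposition (fun z => c * w z) φ (c • T) := fun f z hz => by
  rw [smul_apply, h.eval_smul _ _ hz, hT f z hz, mul_assoc]

theorem IsWeightedComposition.unique {t : ℝ} (h : HasOrder β' t) {w φ w' φ' : ℂ → ℂ}
    {S T : WeightedHardy β →L[ℂ] WeightedHardy β'} (hS : IsWeightedComposition w φ S)
    (hT : IsWeightedComposition w' φ' T) (hw : ∀ z ∈ ball (0 : ℂ) 1, w z = w' z)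
    (hφ : ∀ z ∈ ball (0 : ℂ) 1, φ z = φ' z) : S = T :=
  ContinuousLinearMap.ext fun f => h.ext_eval fun z hz => by
    rw [hS f z hz, hT f z hz, hw z hz, hφ z hz]

theorem isWeightedComposition_of_coeff_eq {T : WeightedHardy β →L[ℂ] WeightedHardy β'}
    (hT : ∀ f n, (T f).coeff n = f.coeff n) : IsWeightedComposition (fun _ => 1) id T :=
  fun f z _ => by
    rw [one_mul]
    exact tsum_congr fun n => by rw [hT]; rfl

/-! ### Multiplication operators -/

/-- Only polynomial growth of the norms in k matters: it is outweighed by geometrically decaying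
coefficients. -/
theorem HasOrder.exists_shift {t : ℝ} (h : HasOrder β t) : ∃ C : ℝ, ∀ k : ℕ,
    ∃ S : WeightedHardy β →L[ℂ] WeightedHardy β,
      IsWeightedComposition (fun z => z ^ k) id S ∧ ‖S‖ ≤ C * ((k : ℝ) + 1) ^ |t| := by
  obtain ⟨C, hC, hb⟩ := h.exists_bounds
  refine ⟨C ^ 2, fun k => ?_⟩
  obtain ⟨S, hS, hSn⟩ := exists_pull (β := β) (β' := β) (c := fun n => if n < k then 0 else 1)
    (τ := fun n => n - k) (C := C ^ 2 * ((k : ℝ) + 1) ^ |t|) (by positivity)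
    (fun n m hn hm hnm => by
      have h1 : ¬ n < k := fun h => hn (if_pos h)
      have h2 : ¬ m < k := fun h => hm (if_pos h)
      omega)
    (fun n => by
      split_ifs with hn
      · rw [norm_zero, mul_zero]
        have := (β (n - k)).2
        positivity
      · obtain ⟨m, rfl⟩ := Nat.exists_eq_add_of_le (not_lt.1 hn)
        rw [norm_one, mul_one, Nat.add_sub_cancel_left]
        -- For t ≥ 0 this is k + m + 1 ≤ (k + 1)(m + 1). For t ≤ 0 the power is decreasing, and the
        -- extra factor is at least 1.
        have hpow : ((k + m : ℕ) + 1 : ℝ) ^ t ≤ ((k : ℝ) + 1) ^ |t| * ((m : ℝ) + 1) ^ t := by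
          rcases le_total 0 t with ht | ht
          · rw [abs_of_nonneg ht, ← Real.mul_rpow (by positivity) (by positivity)]
            refine Real.rpow_le_rpow (by positivity) ?_ ht
            push_cast
            nlinarith [mul_nonneg (Nat.cast_nonneg (α := ℝ) k) (Nat.cast_nonneg (α := ℝ) m)]
          · have h1 : (1 : ℝ) ≤ ((k : ℝ) + 1) ^ |t| :=
              Real.one_le_rpow (by linarith [Nat.cast_nonneg (α := ℝ) k]) (abs_nonneg t)
            refine le_trans ?_ (le_mul_of_one_le_left (by positivity) h1)
            refine Real.rpow_le_rpow_of_nonpos (by positivity) ?_ ht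
            push_cast
            linarith [Nat.cast_nonneg (α := ℝ) k]
        calc (β (k + m) : ℝ) ≤ C * ((k + m : ℕ) + 1 : ℝ) ^ t := (hb _).1
          _ ≤ C * (((k : ℝ) + 1) ^ |t| * ((m : ℝ) + 1) ^ t) :=
            mul_le_mul_of_nonneg_left hpow hC.le
          _ ≤ C * (((k : ℝ) + 1) ^ |t| * (C * (β m : ℝ))) := by
            gcongr
            exact (hb m).2
          _ = _ := by ring)
  refine ⟨S, fun f z hz => ?_, hSn⟩
  refine (h.hasSum_eval (S f) hz).unique ?_
  rw [← hasSum_nat_add_iff' k]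
  have h0 : ∑ n ∈ Finset.range k, (S f).coeff n * z ^ n = 0 :=
    Finset.sum_eq_zero fun n hn => by rw [hS, if_pos (Finset.mem_range.1 hn)]; ring
  rw [h0, sub_zero]
  refine ((h.hasSum_eval f hz).mul_left (z ^ k)).congr_fun ?_
  intro n
  rw [hS, if_neg (by omega), Nat.add_sub_cancel]
  ring

/-- The series of shifts weighted by the Taylor coefficients of G converges absolutely in operator
norm. Pairing with a reproducing kernel identifies the values of its sum. -/
theorem HasOrder.exists_multiplication {t : ℝ} (h : HasOrder β t) {g : ℕ → ℂ} {G : ℂ → ℂ}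
    {M r : ℝ} (hr0 : 0 ≤ r) (hr1 : r < 1) (hg : ∀ k, ‖g k‖ ≤ M * r ^ k)
    (hG : ∀ z ∈ ball (0 : ℂ) 1, HasSum (fun k => g k * z ^ k) (G z)) :
    ∃ T : WeightedHardy β →L[ℂ] WeightedHardy β, IsWeightedComposition G id T := by
  obtain ⟨C, hC⟩ := h.exists_shift
  choose S hS hSn using hC
  have hsum : Summable fun k => g k • S k := by
    refine ((summable_succ_rpow_mul_geometric |t| hr0 hr1).mul_left (M * C)).of_norm_bounded ?_
    intro k
    rw [norm_smul (g k) (S k)]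
    calc ‖g k‖ * ‖S k‖ ≤ (M * r ^ k) * (C * ((k : ℝ) + 1) ^ |t|) :=
          mul_le_mul (hg k) (hSn k) (norm_nonneg (S k)) ((norm_nonneg _).trans (hg k))
      _ = _ := by ring
  refine ⟨∑' k, g k • S k, fun f z hz => ?_⟩
  obtain ⟨κ, -, hκ⟩ := h.exists_kernel hz
  have h1 : HasSum (fun k => (innerSL ℂ κ) ((g k • S k) f))
      ((innerSL ℂ κ) ((∑' k, g k • S k) f)) :=
    (hsum.hasSum.mapL (ContinuousLinearMap.apply ℂ (WeightedHardy β) f)).mapL (innerSL ℂ κ)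
  simp only [innerSL_apply_apply, hκ] at h1
  refine h1.unique (((hG z hz).mul_right (f.eval z)).congr_fun ?_)
  intro k
  rw [smul_apply, h.eval_smul _ _ hz, hS k f z hz, mul_assoc]
  rfl

end WeightedHardy

namespace WeightedHardy

variable {β β' : WeightSeq}

theorem HasOrder.exists_mul_cpow {t : ℝ} (h : HasOrder β t) {a : ℂ} (ha : ‖a‖ < 1) (p : ℂ) :
    ∃ T : WeightedHardy β →L[ℂ] WeightedHardy β,
      IsWeightedComposition (fun z => (a * z + 1) ^ p) id T := by
  -- Any r strictly between ‖a‖ and 1 serves: the binomial series converges at ‖a‖/r < 1, its terms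
  -- there are bounded, and hence the coefficients of (a z + 1)^p are O(r^k).
  set r : ℝ := (‖a‖ + 1) / 2 with hr
  have hr0 : 0 < r := by positivity
  have hr1 : r < 1 := by linarith
  have hsum : ∀ x : ℂ, ‖x‖ < 1 → HasSum (fun n => Ring.choose p n * x ^ n) ((1 + x) ^ p) := by
    intro x hx
    have := (Complex.one_add_cpow_hasFPowerSeriesOnBall_zero (a := p)).hasSum (y := x)
      (by rw [← ENNReal.ofReal_one, Metric.eball_ofReal]; simpa using hx)
    simpa [binomialSeries, FormalMultilinearSeries.ofScalars_apply_eq, mul_comm] using this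
  have hq : ‖((‖a‖ / r : ℝ) : ℂ)‖ < 1 := by
    rw [Complex.norm_real, Real.norm_of_nonneg (by positivity), div_lt_one hr0]
    linarith
  obtain ⟨M, hM⟩ := (hsum _ hq).summable.norm.tendsto_atTop_zero.bddAbove_range
  refine h.exists_multiplication (g := fun n => Ring.choose p n * a ^ n) (M := M) hr0.le hr1
    (fun k => ?_) fun z hz => ?_
  · have := hM (Set.mem_range_self k)
    rw [norm_mul, norm_pow, Complex.norm_real, Real.norm_of_nonneg (by positivity), div_pow,
      ← mul_div_assoc, div_le_iff₀ (by positivity)] at this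
    rwa [norm_mul, norm_pow]
  · have hz1 : ‖z‖ < 1 := by simpa using hz
    have := hsum (a * z) (by
      rw [norm_mul]
      nlinarith [norm_nonneg a, norm_nonneg z])
    rw [add_comm]
    simpa [mul_pow, mul_assoc] using this

/-! ### Differentiation -/

theorem exists_derivative (β : WeightSeq) :
    ∃ D : WeightedHardy β →L[ℂ] WeightedHardy (derivWeight β),
      ∀ f n, (D f).coeff n = ((n : ℂ) + 1) * f.coeff (n + 1) := by
  obtain ⟨D, hD, -⟩ := exists_pull (β := β) (β' := derivWeight β) (c := fun n => (n : ℂ) + 1)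
    (τ := fun n => n + 1) (C := 1) zero_le_one (fun n m _ _ h => Nat.succ_injective h)
    (fun n => by
      have : ‖(n : ℂ) + 1‖ = (n : ℝ) + 1 := by exact_mod_cast Complex.norm_natCast (n + 1)
      rw [this, derivWeight_apply, one_mul, div_mul_cancel₀ _ (by positivity)])
  exact ⟨D, hD⟩

variable {D : WeightedHardy β →L[ℂ] WeightedHardy (derivWeight β)}

/-- The adjoint is integration from 0: the target weights β(n+1)/(n+1) are exactly those for which
the antiderivative without constant term is the adjoint of differentiation. -/
theorem coeff_adjoint_derivative
    (hD : ∀ f n, (D f).coeff n = ((n : ℂ) + 1) * f.coeff (n + 1)) :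
    (∀ g, (ContinuousLinearMap.adjoint D g).coeff 0 = 0) ∧
      ∀ g n, (ContinuousLinearMap.adjoint D g).coeff (n + 1) = g.coeff n / ((n : ℂ) + 1) := by
  obtain ⟨E, hE, -⟩ := exists_pull (β := derivWeight β) (β' := β)
    (c := fun n => if n = 0 then 0 else (n : ℂ)⁻¹) (τ := fun n => n - 1) (C := 1) zero_le_one
    (fun n m hn hm h => by
      have h1 : n ≠ 0 := fun h => hn (if_pos h)
      have h2 : m ≠ 0 := fun h => hm (if_pos h)
      omega)
    (fun n => by
      rcases n with _ | n
      · simpa using (derivWeight β 0).2.le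
      · rw [if_neg (Nat.succ_ne_zero n), norm_inv, Complex.norm_natCast, one_mul,
          Nat.add_sub_cancel, derivWeight_apply, Nat.cast_succ, div_eq_mul_inv])
  have hED : E = ContinuousLinearMap.adjoint D := by
    rw [ContinuousLinearMap.eq_adjoint_iff]
    intro g f
    refine (hasSum_inner (E g) f).unique ?_
    rw [← hasSum_nat_add_iff' 1]
    simp only [Finset.range_one, Finset.sum_singleton, hE, if_true, zero_mul, map_zero, mul_zero,
      sub_zero]
    refine (hasSum_inner g (D f)).congr_fun ?_
    intro n
    have hn : (n : ℂ) + 1 ≠ 0 := Nat.cast_add_one_ne_zero n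
    rw [if_neg (Nat.succ_ne_zero n), hD, Nat.add_sub_cancel, derivWeight_apply, map_mul, map_inv₀]
    push_cast
    rw [map_add, map_one, Complex.conj_natCast]
    field_simp
  rw [← hED]
  refine ⟨fun g => by rw [hE, if_pos rfl, zero_mul], fun g n => ?_⟩
  rw [hE, if_neg (Nat.succ_ne_zero n), Nat.add_sub_cancel, Nat.cast_succ, inv_mul_eq_div]

theorem derivative_comp_adjoint
    (hD : ∀ f n, (D f).coeff n = ((n : ℂ) + 1) * f.coeff (n + 1)) :
    D.comp (ContinuousLinearMap.adjoint D) = ContinuousLinearMap.id ℂ _ :=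
  ext_coeff fun g n => by
    rw [ContinuousLinearMap.comp_apply, hD, (coeff_adjoint_derivative hD).2,
      mul_div_cancel₀ _ (Nat.cast_add_one_ne_zero n)]
    rfl

/-- Integrating the derivative loses only the constant term, so the difference is a rank-one
projection. -/
theorem isCompactOperator_id_sub_adjoint_comp_derivative
    (hD : ∀ f n, (D f).coeff n = ((n : ℂ) + 1) * f.coeff (n + 1)) :
    IsCompactOperator
      (ContinuousLinearMap.id ℂ (WeightedHardy β) - (ContinuousLinearMap.adjoint D).comp D) := by
  refine isCompactOperator_of_coeff_eq_zero 1 (c := fun n => if n = 0 then 1 else 0)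
    (fun f n => ?_) fun n hn => if_neg (by omega)
  rw [sub_apply, coeff_sub, ContinuousLinearMap.comp_apply, ContinuousLinearMap.id_apply]
  rcases n with _ | n
  · rw [(coeff_adjoint_derivative hD).1]
    simp
  · rw [(coeff_adjoint_derivative hD).2, hD,
      mul_div_cancel_left₀ _ (Nat.cast_add_one_ne_zero n)]
    simp

/-- Termwise differentiation on a disk of radius r with |z| < r < 1, dominated by the absolutely
convergent series of D f at r. -/
theorem HasOrder.hasDerivAt_eval {t : ℝ} (h : HasOrder β t)
    (hD : ∀ f n, (D f).coeff n = ((n : ℂ) + 1) * f.coeff (n + 1)) (f : WeightedHardy β) {z : ℂ}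
    (hz : z ∈ ball (0 : ℂ) 1) : HasDerivAt f.eval ((D f).eval z) z := by
  have hz1 : ‖z‖ < 1 := by simpa using hz
  obtain ⟨r, hzr, hr1⟩ := exists_between hz1
  have hr0 : 0 ≤ r := (norm_nonneg z).trans hzr.le
  have hu : Summable fun n : ℕ => ‖f.coeff n‖ * (n * r ^ (n - 1)) := by
    rw [← summable_nat_add_iff 1]
    have := (h.hasOrder_derivWeight.hasSum_eval (D f) (z := (r : ℂ))
      (by simpa [abs_of_nonneg hr0] using hr1)).summable.norm
    refine this.congr fun n => ?_
    have hn : ‖(n : ℂ) + 1‖ = (n : ℝ) + 1 := by exact_mod_cast Complex.norm_natCast (n + 1)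
    rw [hD, norm_mul, norm_mul, norm_pow, hn, Complex.norm_real, Real.norm_of_nonneg hr0,
      Nat.add_sub_cancel]
    push_cast
    ring
  have key := hasDerivAt_tsum_of_isPreconnected (𝕜 := ℂ) hu isOpen_ball
    (convex_ball (0 : ℂ) r).isPreconnected (g := fun n z => f.coeff n * z ^ n)
    (g' := fun n z => f.coeff n * (n * z ^ (n - 1)))
    (fun n y _ => (hasDerivAt_pow n y).const_mul _)
    (fun n y hy => by
      have hy1 : ‖y‖ ≤ r := by simpa using (mem_ball.1 hy).le
      rw [norm_mul, norm_mul, norm_pow, Complex.norm_natCast]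
      gcongr)
    (y₀ := z) (y := z) (by simpa using hzr) (h.hasSum_eval f hz).summable (by simpa using hzr)
  have heq : ∑' n : ℕ, f.coeff n * (n * z ^ (n - 1)) = (D f).eval z := by
    refine HasSum.tsum_eq ?_
    rw [← hasSum_nat_add_iff' 1]
    simp only [Finset.range_one, Finset.sum_singleton, Nat.cast_zero, zero_mul, mul_zero, sub_zero]
    refine (h.hasOrder_derivWeight.hasSum_eval (D f) hz).congr_fun ?_
    intro n
    rw [hD, Nat.add_sub_cancel]
    push_cast
    ring
  rwa [heq] at key

theorem HasOrder.eval_derivative_comp {t : ℝ} (h : HasOrder β t)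
    (hD : ∀ f n, (D f).coeff n = ((n : ℂ) + 1) * f.coeff (n + 1)) {w φ w' φ' : ℂ → ℂ}
    {T : WeightedHardy β →L[ℂ] WeightedHardy β} (hT : IsWeightedComposition w φ T)
    (hφ : ∀ z ∈ ball (0 : ℂ) 1, φ z ∈ ball (0 : ℂ) 1)
    (hw' : ∀ z ∈ ball (0 : ℂ) 1, HasDerivAt w (w' z) z)
    (hφ' : ∀ z ∈ ball (0 : ℂ) 1, HasDerivAt φ (φ' z) z) (f : WeightedHardy β) {z : ℂ}
    (hz : z ∈ ball (0 : ℂ) 1) :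
    (D (T f)).eval z = w' z * f.eval (φ z) + w z * ((D f).eval (φ z) * φ' z) := by
  have h1 := h.hasDerivAt_eval hD (T f) hz
  have h2 := (hw' z hz).mul ((h.hasDerivAt_eval hD f (hφ z hz)).comp z (hφ' z hz))
  refine h1.unique (h2.congr_of_eventuallyEq ?_)
  filter_upwards [isOpen_ball.mem_nhds hz] with y hy
  exact hT f y hy

theorem HasOrder.derivative_comp_composition {t : ℝ} (h : HasOrder β t)
    (hD : ∀ f n, (D f).coeff n = ((n : ℂ) + 1) * f.coeff (n + 1)) {φ φ' : ℂ → ℂ}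
    {T : WeightedHardy β →L[ℂ] WeightedHardy β} (hT : IsWeightedComposition (fun _ => 1) φ T)
    {S : WeightedHardy (derivWeight β) →L[ℂ] WeightedHardy (derivWeight β)}
    (hS : IsWeightedComposition φ' φ S)
    (hφ : ∀ z ∈ ball (0 : ℂ) 1, φ z ∈ ball (0 : ℂ) 1)
    (hφ' : ∀ z ∈ ball (0 : ℂ) 1, HasDerivAt φ (φ' z) z) : D.comp T = S.comp D :=
  ContinuousLinearMap.ext fun f => h.hasOrder_derivWeight.ext_eval fun z hz => by
    rw [ContinuousLinearMap.comp_apply, ContinuousLinearMap.comp_apply, hS _ z hz,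
      h.eval_derivative_comp hD hT hφ (fun z _ => hasDerivAt_const z 1) hφ' f hz]
    ring

/-- The product rule; the term containing the derivative of the multiplier passes through the
inclusion J and is compact once J is. -/
theorem HasOrder.derivative_comp_multiplication {t : ℝ} (h : HasOrder β t)
    (hD : ∀ f n, (D f).coeff n = ((n : ℂ) + 1) * f.coeff (n + 1)) {w w' : ℂ → ℂ}
    {T T' : WeightedHardy β →L[ℂ] WeightedHardy β} (hT : IsWeightedComposition w id T)
    (hT' : IsWeightedComposition w' id T')
    {S : WeightedHardy (derivWeight β) →L[ℂ] WeightedHardy (derivWeight β)}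
    (hS : IsWeightedComposition w id S) {J : WeightedHardy β →L[ℂ] WeightedHardy (derivWeight β)}
    (hJ : ∀ f n, (J f).coeff n = f.coeff n)
    (hw' : ∀ z ∈ ball (0 : ℂ) 1, HasDerivAt w (w' z) z) :
    D.comp T = S.comp D + J.comp T' :=
  ContinuousLinearMap.ext fun f => h.hasOrder_derivWeight.ext_eval fun z hz => by
    rw [add_apply, h.hasOrder_derivWeight.eval_add _ _ hz, ContinuousLinearMap.comp_apply,
      ContinuousLinearMap.comp_apply, ContinuousLinearMap.comp_apply, hS _ z hz,
      isWeightedComposition_of_coeff_eq hJ _ z hz, id, hT' _ z hz,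
      h.eval_derivative_comp hD hT (fun _ h => h) hw' (fun z _ => hasDerivAt_id z) f hz]
    simp only [id]
    ring

/-- The weight ratio is of order 1/n. The adjoint has entries equal to the square of that ratio and
maps in the opposite direction, so its effective entries are the same ratio. -/
theorem HasOrder.exists_inclusion_derivWeight {t : ℝ} (h : HasOrder β t) :
    ∃ J : WeightedHardy β →L[ℂ] WeightedHardy (derivWeight β),
      (∀ f n, (J f).coeff n = f.coeff n) ∧ IsCompactOperator J ∧
      IsCompactOperator (ContinuousLinearMap.adjoint J) := by
  have hlim := h.tendsto_div_zero h.hasOrder_derivWeight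
  obtain ⟨C, hC⟩ := hlim.bddAbove_range
  obtain ⟨J, hJ, -⟩ := exists_diagonal (β := β) (β' := derivWeight β) (c := fun _ => 1) (C := C)
    (fun n => by
      rw [norm_one, mul_one, ← div_le_iff₀ (β n).2]
      exact hC (Set.mem_range_self n))
  refine ⟨J, fun f n => by rw [hJ, one_mul], isCompactOperator_of_diagonal hJ ?_,
    isCompactOperator_of_diagonal (adjoint_diagonal hJ) ?_⟩
  · simpa using hlim
  · refine hlim.congr fun n => ?_
    have h1 := (β n).2
    have h2 := (derivWeight β n).2
    rw [map_one, mul_one, norm_pow, norm_div, Complex.norm_real, Complex.norm_real,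
      Real.norm_of_nonneg h1.le, Real.norm_of_nonneg h2.le]
    field_simp

/-- If `φ' · (g ∘ φ)` is a bounded operator on the space of derivatives, then composition with
`φ` is a bounded operator. -/
theorem HasOrder.exists_composition_of_derivWeight {t : ℝ} (h : HasOrder β t) {φ φ' : ℂ → ℂ}
    {S : WeightedHardy (derivWeight β) →L[ℂ] WeightedHardy (derivWeight β)}
    (hS : IsWeightedComposition φ' φ S)
    (hφ : ∀ z ∈ ball (0 : ℂ) 1, φ z ∈ ball (0 : ℂ) 1)
    (hφ' : ∀ z ∈ ball (0 : ℂ) 1, HasDerivAt φ (φ' z) z) :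
    ∃ T : WeightedHardy β →L[ℂ] WeightedHardy β, IsWeightedComposition (fun _ => 1) φ T := by
  obtain ⟨D, hD⟩ := exists_derivative β
  obtain ⟨k, -, hk⟩ := h.exists_kernel (hφ 0 (mem_ball_self one_pos))
  let e : WeightedHardy β :=
    ⟨Pi.single 0 1, by
      refine memℓp_gen (summable_of_ne_finset_zero (s := {0}) fun n hn => ?_)
      have : n ≠ 0 := by simpa using hn
      simp [this]⟩
  have he0 : ∀ n, n ≠ 0 → e.coeff n = 0 := fun n hn => Pi.single_eq_of_ne hn _
  have he1 : e.coeff 0 = 1 := by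
    change (Pi.single 0 1 : ℕ → ℂ) 0 = 1
    rw [Pi.single_eq_same]
  have hz0 : ∀ f : WeightedHardy β, f.eval 0 = f.coeff 0 := fun f => by
    refine (tsum_eq_single 0 fun n hn => ?_).trans (by simp)
    rw [zero_pow hn, mul_zero]
  -- The function f ∘ φ is recovered as its value f(φ(0)) at 0 plus the integral of its derivative
  -- φ' · (f' ∘ φ). The kernel at φ(0) makes the first term bounded.
  refine ⟨(ContinuousLinearMap.toSpanSingleton ℂ e).comp (innerSL ℂ k) +
    (ContinuousLinearMap.adjoint D).comp (S.comp D), fun f => ?_⟩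
  set F := ((ContinuousLinearMap.toSpanSingleton ℂ e).comp (innerSL ℂ k) +
    (ContinuousLinearMap.adjoint D).comp (S.comp D)) f with hF
  have hF' : F = f.eval (φ 0) • e + ContinuousLinearMap.adjoint D (S (D f)) := by
    rw [hF, ← hk]
    simp
  have hDF : D F = S (D f) := by
    rw [hF', map_add, map_smul]
    have h1 : D e = 0 := coeff_injective fun n => by
      rw [hD, he0 _ (Nat.succ_ne_zero n), mul_zero]; rfl
    rw [h1, smul_zero, zero_add]
    exact DFunLike.congr_fun (derivative_comp_adjoint hD) (S (D f))
  have hF0 : F.eval 0 = f.eval (φ 0) := by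
    rw [hz0, hF', coeff_add, coeff_smul, he1, (coeff_adjoint_derivative hD).1]
    ring
  have hd1 : ∀ z ∈ ball (0 : ℂ) 1, HasDerivAt F.eval ((S (D f)).eval z) z := fun z hz =>
    hDF ▸ h.hasDerivAt_eval hD F hz
  have hd2 : ∀ z ∈ ball (0 : ℂ) 1,
      HasDerivAt (fun z => f.eval (φ z)) ((S (D f)).eval z) z := fun z hz => by
    have := (h.hasDerivAt_eval hD f (hφ z hz)).comp z (hφ' z hz)
    rwa [mul_comm, ← hS (D f) z hz] at this
  intro z hz
  rw [one_mul]
  exact isOpen_ball.eqOn_of_deriv_eq (convex_ball (0 : ℂ) 1).isPreconnected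
    (fun z hz => (hd1 z hz).differentiableAt.differentiableWithinAt)
    (fun z hz => (hd2 z hz).differentiableAt.differentiableWithinAt)
    (fun z hz => by rw [(hd1 z hz).deriv, (hd2 z hz).deriv]) (mem_ball_self one_pos) hF0 hz

end WeightedHardy

/-! ### Transfer of the adjoint formula modulo compact operators -/

section CompactPerturbation

open ContinuousLinearMap

variable {E F : Type*} [NormedAddCommGroup E] [InnerProductSpace ℂ E] [CompleteSpace E]
  [NormedAddCommGroup F] [InnerProductSpace ℂ F] [CompleteSpace F]

/-- The formula `C^* = G^* C' M` modulo compact operators passes from `F` to `E` along an operator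
`D : E → F` that intertwines the operators up to compact ones, if `D^* D` is a compact perturbation
of the identity. -/
theorem isCompactOperator_adjoint_sub_of_intertwining {D : E →L[ℂ] F}
    (hD : IsCompactOperator (ContinuousLinearMap.id ℂ E - (adjoint D).comp D))
    {C C' MG MF M₁ M₂ X Y : F →L[ℂ] F} {Cb Cb' MGb MFb : E →L[ℂ] E} {J₁ J₂ : E →L[ℂ] F}
    (hJ₁ : IsCompactOperator (adjoint J₁)) (hJ₂ : IsCompactOperator J₂) {c c' : ℂ}
    (hc : starRingEnd ℂ c * c' = 1) (h₁ : D.comp Cb = (C.comp M₁).comp D)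
    (h₂ : D.comp Cb' = (C'.comp M₂).comp D) (h₃ : D.comp MGb = X.comp D + J₁)
    (h₄ : D.comp MFb = Y.comp D + J₂) (h₅ : MG.comp M₁ = c • X) (h₆ : MF = c' • M₂.comp Y)
    (hK : IsCompactOperator (adjoint C - (adjoint MG).comp (C'.comp MF))) :
    IsCompactOperator (adjoint Cb - (adjoint MGb).comp (Cb'.comp MFb)) := by
  set P := ContinuousLinearMap.id ℂ E - (adjoint D).comp D with hP
  set K := adjoint C - (adjoint MG).comp (C'.comp MF) with hKdef
  have e₁ : ∀ y, adjoint Cb (adjoint D y) = adjoint D (adjoint M₁ (adjoint C y)) := fun y => by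
    have := congrArg (fun T => adjoint T y) h₁
    simpa [adjoint_comp] using this
  have e₃ : ∀ y, adjoint MGb (adjoint D y) = adjoint D (adjoint X y) + adjoint J₁ y := fun y => by
    have := congrArg (fun T => adjoint T y) h₃
    simpa [adjoint_comp] using this
  have e₅ : ∀ y, adjoint M₁ (adjoint MG y) = starRingEnd ℂ c • adjoint X y := fun y => by
    have := congrArg (fun T => adjoint T y) h₅
    simpa [adjoint_comp, map_smulₛₗ] using this
  have e₂ : ∀ x, D (Cb' x) = C' (M₂ (D x)) := fun x => DFunLike.congr_fun h₂ x
  have e₄ : ∀ x, D (MFb x) = Y (D x) + J₂ x := fun x => DFunLike.congr_fun h₄ x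
  -- Insert D^* D = 1 - P to the right of Cb^*, move D across by the intertwining relations, replace
  -- C^* by K plus its model, and move D back. The scalars cancel since conj c · c' = 1. Each error
  -- contains one of P, K, J₂ or J₁^*.
  have key : adjoint Cb - (adjoint MGb).comp (Cb'.comp MFb) =
      (adjoint Cb).comp P + ((adjoint D).comp (adjoint M₁)).comp (K.comp D) -
        (((adjoint MGb).comp (adjoint D)).comp (C'.comp M₂)).comp J₂ -
        (adjoint J₁).comp ((C'.comp M₂).comp (Y.comp D)) -
        (adjoint MGb).comp (P.comp (Cb'.comp MFb)) := by
    ext x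
    have hx : adjoint Cb (adjoint D (D x)) = adjoint D (adjoint M₁ (adjoint C (D x))) := e₁ _
    have hm : adjoint M₁ (adjoint MG (C' (MF (D x)))) = adjoint X (C' (M₂ (Y (D x)))) := by
      rw [e₅, h₆]
      simp only [FunLike.coe_smul, Pi.smul_apply, comp_apply, map_smul, smul_smul, hc, one_smul]
    have hg := e₃ (C' (M₂ (Y (D x))))
    have h2 := congrArg (fun y => adjoint MGb (adjoint D y)) (e₂ (MFb x))
    simp only [e₄, map_add] at h2
    simp only [hP, hKdef, sub_apply, add_apply, comp_apply, id_apply, map_sub, hx, hm, h2, hg]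
    abel
  rw [key]
  have c₁ : IsCompactOperator ((adjoint Cb).comp P) := hD.clm_comp (adjoint Cb)
  have c₂ : IsCompactOperator (((adjoint D).comp (adjoint M₁)).comp (K.comp D)) :=
    (hK.comp_clm D).clm_comp ((adjoint D).comp (adjoint M₁))
  have c₃ : IsCompactOperator ((((adjoint MGb).comp (adjoint D)).comp (C'.comp M₂)).comp J₂) :=
    hJ₂.clm_comp (((adjoint MGb).comp (adjoint D)).comp (C'.comp M₂))
  have c₄ : IsCompactOperator ((adjoint J₁).comp ((C'.comp M₂).comp (Y.comp D))) :=
    hJ₁.comp_clm _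
  have c₅ : IsCompactOperator ((adjoint MGb).comp (P.comp (Cb'.comp MFb))) :=
    (hD.comp_clm (Cb'.comp MFb)).clm_comp (adjoint MGb)
  exact (((c₁.add c₂).sub c₃).sub c₄).sub c₅

/-- The formula `C^* = G^* C' M` modulo compact operators is preserved by a similarity that is
a compact perturbation of a multiple of a unitary operator. -/
theorem isCompactOperator_adjoint_sub_of_similarity {W : E →L[ℂ] F} {V : F →L[ℂ] E}
    (hWV : W.comp V = ContinuousLinearMap.id ℂ F) {c c' : ℂ} (hc : c * c' = 1)
    (hW : IsCompactOperator (adjoint W - c • V)) (hV : IsCompactOperator (adjoint V - c' • W))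
    {C C' MG MF : F →L[ℂ] F}
    (hK : IsCompactOperator (adjoint C - (adjoint MG).comp (C'.comp MF))) :
    IsCompactOperator (adjoint (V.comp (C.comp W)) -
      (adjoint (V.comp (MG.comp W))).comp
        ((V.comp (C'.comp W)).comp (V.comp (MF.comp W)))) := by
  have e : ∀ y, W (V y) = y := fun y => DFunLike.congr_fun hWV y
  -- Modulo compact operators W^* is c V and V^* is c' W, so with c c' = 1 conjugation by this
  -- similarity commutes with taking adjoints.
  have aux : ∀ T : F →L[ℂ] F, IsCompactOperator
      (adjoint (V.comp (T.comp W)) - V.comp ((adjoint T).comp W)) := by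
    intro T
    have key : adjoint (V.comp (T.comp W)) - V.comp ((adjoint T).comp W) =
        ((adjoint W).comp (adjoint T)).comp (adjoint V - c' • W) +
          (adjoint W - c • V).comp (c' • (adjoint T).comp W) := by
      ext x
      simp only [adjoint_comp, sub_apply, add_apply, comp_apply, map_sub, FunLike.coe_smul,
        Pi.smul_apply, map_smul]
      rw [smul_sub, smul_smul, mul_comm c' c, hc, one_smul]
      abel
    rw [key]
    have c₁ : IsCompactOperator
        (((adjoint W).comp (adjoint T)).comp (adjoint V - c' • W)) :=
      hV.clm_comp ((adjoint W).comp (adjoint T))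
    have c₂ : IsCompactOperator ((adjoint W - c • V).comp (c' • (adjoint T).comp W)) :=
      hW.comp_clm _
    exact c₁.add c₂
  have key : adjoint (V.comp (C.comp W)) - (adjoint (V.comp (MG.comp W))).comp
        ((V.comp (C'.comp W)).comp (V.comp (MF.comp W))) =
      (adjoint (V.comp (C.comp W)) - V.comp ((adjoint C).comp W)) -
        (adjoint (V.comp (MG.comp W)) - V.comp ((adjoint MG).comp W)).comp
          ((V.comp (C'.comp W)).comp (V.comp (MF.comp W))) +
        V.comp ((adjoint C - (adjoint MG).comp (C'.comp MF)).comp W) := by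
    ext x
    simp only [sub_apply, add_apply, comp_apply, map_sub, e]
    abel
  rw [key]
  have c₁ : IsCompactOperator ((adjoint (V.comp (MG.comp W)) - V.comp ((adjoint MG).comp W)).comp
          ((V.comp (C'.comp W)).comp (V.comp (MF.comp W)))) := (aux MG).comp_clm _
  have c₂ : IsCompactOperator (V.comp ((adjoint C - (adjoint MG).comp (C'.comp MF)).comp W)) :=
    (hK.comp_clm W).clm_comp V
  exact ((aux C).sub c₁).add c₂

end CompactPerturbation

/-! ### Automorphisms of the disk -/

theorem re_mul_add_one_pos {a z : ℂ} (ha : ‖a‖ < 1) (hz : z ∈ ball (0 : ℂ) 1) :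
    0 < (a * z + 1).re := by
  have hz1 : ‖z‖ < 1 := by simpa using hz
  have h1 := Complex.abs_re_le_norm (a * z)
  rw [norm_mul] at h1
  have h2 := (abs_le.1 h1).1
  rw [Complex.add_re, Complex.one_re]
  nlinarith [norm_nonneg a, norm_nonneg z]

theorem mul_add_one_ne_zero {a z : ℂ} (ha : ‖a‖ < 1) (hz : z ∈ ball (0 : ℂ) 1) :
    a * z + 1 ≠ 0 := fun h => by
  have := re_mul_add_one_pos ha hz
  rw [h, Complex.zero_re] at this
  exact this.false

theorem one_sub_conj_mul_ne_zero {u : ℂ} (hu : ‖u‖ < 1) : 1 - starRingEnd ℂ u * u ≠ 0 := by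
  rw [Complex.conj_mul', sub_ne_zero]
  intro h
  have : ‖u‖ ^ 2 = 1 := by exact_mod_cast h.symm
  nlinarith [norm_nonneg u]

section DiskAut

variable {lam u : ℂ}

theorem conj_mul_self_of_norm_eq_one (hlam : ‖lam‖ = 1) : starRingEnd ℂ lam * lam = 1 := by
  rw [Complex.conj_mul', hlam]
  simp

theorem norm_neg_conj_mul_lt_one (hlam : ‖lam‖ = 1) (hu : ‖u‖ < 1) :
    ‖-starRingEnd ℂ (lam * u)‖ < 1 := by
  rw [norm_neg, Complex.norm_conj, norm_mul, hlam, one_mul]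
  exact hu

theorem norm_conj_lt_one (hu : ‖u‖ < 1) : ‖starRingEnd ℂ u‖ < 1 := by
  rwa [Complex.norm_conj]

theorem diskAut_mem_ball (hlam : ‖lam‖ = 1) (hu : ‖u‖ < 1) {z : ℂ} (hz : z ∈ ball (0 : ℂ) 1) :
    diskAut lam u z ∈ ball (0 : ℂ) 1 := by
  have hz1 : ‖z‖ < 1 := by simpa using hz
  have hne := mul_add_one_ne_zero (norm_conj_lt_one hu) hz
  rw [add_comm] at hne
  rw [mem_ball_zero_iff, diskAut, norm_div, norm_mul, hlam, one_mul,
    div_lt_one (norm_pos_iff.2 hne)]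
  refine lt_of_pow_lt_pow_left₀ 2 (norm_nonneg _) ?_
  have h1 : ‖u‖ ^ 2 < 1 := by nlinarith [norm_nonneg u]
  have h2 : ‖z‖ ^ 2 < 1 := by nlinarith [norm_nonneg z]
  simp only [← Complex.normSq_eq_norm_sq, Complex.normSq_apply, Complex.add_re, Complex.add_im,
    Complex.mul_re, Complex.mul_im, Complex.conj_re, Complex.conj_im, Complex.one_re,
    Complex.one_im] at h1 h2 ⊢
  nlinarith [mul_pos (sub_pos.2 h1) (sub_pos.2 h2)]

/-- Up to a constant, the denominator of φ is the inverse of the linear factor of G taken at φ(z).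
This lets powers of one be traded for powers of the other, in particular in φ'. -/
theorem mul_diskAut_add_one (hlam : ‖lam‖ = 1) (hu : ‖u‖ < 1) {z : ℂ}
    (hz : z ∈ ball (0 : ℂ) 1) :
    (starRingEnd ℂ u * z + 1) * (-starRingEnd ℂ (lam * u) * diskAut lam u z + 1) =
      1 - starRingEnd ℂ u * u := by
  have hne := mul_add_one_ne_zero (norm_conj_lt_one hu) hz
  have hne' : 1 + starRingEnd ℂ u * z ≠ 0 := by rwa [add_comm]
  have hl := conj_mul_self_of_norm_eq_one hlam
  rw [diskAut, map_mul]
  field_simp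
  linear_combination (-starRingEnd ℂ u * (z + u) * (starRingEnd ℂ u * z + 1)) * hl

/-- The covariance of 1 - conj w z under automorphisms, which drives all the kernel computations. -/
theorem kernel_diskAut (hlam : ‖lam‖ = 1) (hu : ‖u‖ < 1) {w z : ℂ}
    (hw : w ∈ ball (0 : ℂ) 1) (hz : z ∈ ball (0 : ℂ) 1) :
    (1 - starRingEnd ℂ w * z) * (-starRingEnd ℂ (lam * u) * diskAut lam u z + 1) =
      (u * starRingEnd ℂ w + 1) * (1 - starRingEnd ℂ (diskAut lam u w) * diskAut lam u z) := by
  have hne := mul_add_one_ne_zero (norm_conj_lt_one hu) hz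
  have hne' : 1 + z * starRingEnd ℂ u ≠ 0 := by rwa [add_comm, mul_comm]
  have hw' : starRingEnd ℂ w ∈ ball (0 : ℂ) 1 := by simpa using hw
  have hne2 := mul_add_one_ne_zero hu hw'
  have hne2' : 1 + starRingEnd ℂ w * u ≠ 0 := by rwa [add_comm, mul_comm]
  have hl := conj_mul_self_of_norm_eq_one hlam
  simp only [diskAut, map_div₀, map_mul, map_add, map_one, Complex.conj_conj]
  field_simp
  linear_combination (-starRingEnd ℂ u * (z + u) * (1 - starRingEnd ℂ w * z) *
    (1 + starRingEnd ℂ w * u) + (1 + starRingEnd ℂ w * u) * (z + u) *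
      (starRingEnd ℂ w + starRingEnd ℂ u)) * hl

/-- The inverse of a disk automorphism is a disk automorphism. -/
theorem diskAut_conj_diskAut (hlam : ‖lam‖ = 1) (hu : ‖u‖ < 1) {z : ℂ}
    (hz : z ∈ ball (0 : ℂ) 1) :
    diskAut (starRingEnd ℂ lam) (-(lam * u)) (diskAut lam u z) = z := by
  have hne := mul_add_one_ne_zero (norm_conj_lt_one hu) hz
  have hne' : 1 + z * starRingEnd ℂ u ≠ 0 := by rwa [add_comm, mul_comm]
  have hl := conj_mul_self_of_norm_eq_one hlam
  have h := mul_diskAut_add_one hlam hu hz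
  have he := one_sub_conj_mul_ne_zero hu
  have hd : 1 + starRingEnd ℂ (-(lam * u)) * diskAut lam u z ≠ 0 := by
    intro h0
    rw [map_neg, add_comm] at h0
    rw [h0, mul_zero] at h
    exact he h.symm
  rw [diskAut, div_eq_iff hd]
  rw [map_neg, map_mul, diskAut]
  field_simp
  linear_combination ((z + u) - u * (1 + z * starRingEnd ℂ u) + z * (z + u) * starRingEnd ℂ u) * hl

theorem norm_conj_eq_one (hlam : ‖lam‖ = 1) : ‖starRingEnd ℂ lam‖ = 1 := by
  rwa [Complex.norm_conj]

theorem norm_neg_mul_lt_one (hlam : ‖lam‖ = 1) (hu : ‖u‖ < 1) : ‖-(lam * u)‖ < 1 := by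
  rwa [norm_neg, norm_mul, hlam, one_mul]

theorem neg_conj_mul_neg_mul (hlam : ‖lam‖ = 1) :
    -(starRingEnd ℂ lam * -(lam * u)) = u := by
  rw [mul_neg, neg_neg, ← mul_assoc, conj_mul_self_of_norm_eq_one hlam, one_mul]

theorem diskAut_diskAut_conj (hlam : ‖lam‖ = 1) (hu : ‖u‖ < 1) {z : ℂ}
    (hz : z ∈ ball (0 : ℂ) 1) :
    diskAut lam u (diskAut (starRingEnd ℂ lam) (-(lam * u)) z) = z := by
  have := diskAut_conj_diskAut (norm_conj_eq_one hlam) (norm_neg_mul_lt_one hlam hu) hz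
  rwa [neg_conj_mul_neg_mul hlam, Complex.conj_conj] at this

theorem mul_diskAut_conj_add_one (hlam : ‖lam‖ = 1) (hu : ‖u‖ < 1) {z : ℂ}
    (hz : z ∈ ball (0 : ℂ) 1) :
    (-starRingEnd ℂ (lam * u) * z + 1) *
      (starRingEnd ℂ u * diskAut (starRingEnd ℂ lam) (-(lam * u)) z + 1) =
      1 - starRingEnd ℂ u * u := by
  have := mul_diskAut_add_one (norm_conj_eq_one hlam) (norm_neg_mul_lt_one hlam hu) hz
  rw [← map_neg, neg_conj_mul_neg_mul hlam, map_neg] at this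
  rw [this]
  have hl := conj_mul_self_of_norm_eq_one hlam
  rw [map_mul]
  linear_combination (-starRingEnd ℂ u * u) * hl

theorem diskAutInv_eq (hlam : ‖lam‖ = 1) (hu : ‖u‖ < 1) {z : ℂ} (hz : z ∈ ball (0 : ℂ) 1) :
    diskAutInv lam u z = diskAut (starRingEnd ℂ lam) (-(lam * u)) z := by
  have hmem := diskAut_mem_ball (norm_conj_eq_one hlam) (norm_neg_mul_lt_one hlam hu) hz
  have hex : ∃ x ∈ ball (0 : ℂ) 1, diskAut lam u x = z :=
    ⟨_, hmem, diskAut_diskAut_conj hlam hu hz⟩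
  have h1 := Function.invFunOn_mem hex
  have h2 := Function.invFunOn_eq hex
  have h3 := diskAut_conj_diskAut hlam hu h1
  rw [h2] at h3
  exact h3.symm

theorem hasDerivAt_diskAut (hu : ‖u‖ < 1) {z : ℂ} (hz : z ∈ ball (0 : ℂ) 1) :
    HasDerivAt (diskAut lam u)
      (lam * (1 - starRingEnd ℂ u * u) / (starRingEnd ℂ u * z + 1) ^ 2) z := by
  have hne := mul_add_one_ne_zero (norm_conj_lt_one hu) hz
  have hne' : 1 + starRingEnd ℂ u * z ≠ 0 := by rwa [add_comm]
  have h1 : HasDerivAt (fun z : ℂ => lam * (z + u)) (lam * 1) z :=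
    ((hasDerivAt_id z).add_const u).const_mul lam
  have h2 : HasDerivAt (fun z : ℂ => 1 + starRingEnd ℂ u * z) (starRingEnd ℂ u * 1) z :=
    ((hasDerivAt_id z).const_mul _).const_add 1
  have h3 := h1.div h2 hne'
  have heq : (lam * 1 * (1 + starRingEnd ℂ u * z) - lam * (z + u) * (starRingEnd ℂ u * 1)) /
      (1 + starRingEnd ℂ u * z) ^ 2 =
      lam * (1 - starRingEnd ℂ u * u) / (starRingEnd ℂ u * z + 1) ^ 2 := by
    rw [add_comm (starRingEnd ℂ u * z) 1]
    congr 1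
    ring
  rw [heq] at h3
  exact h3

end DiskAut

/-- Principal powers are compatible with identities between products of two numbers in the right
half-plane. -/
theorem mul_cpow_eq_mul_cpow_of_re_pos {a b c d : ℂ} (ha : 0 < a.re) (hb : 0 < b.re)
    (hc : 0 < c.re) (hd : 0 < d.re) (h : a * b = c * d) (p : ℂ) :
    a ^ p * b ^ p = c ^ p * d ^ p := by
  have ne : ∀ {x : ℂ}, 0 < x.re → x ≠ 0 := fun hx h => by simp [h] at hx
  have arg : ∀ {x : ℂ}, 0 < x.re → |(Complex.log x).im| < Real.pi / 2 := fun hx => by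
    rw [Complex.log_im]
    exact Complex.abs_arg_lt_pi_div_two_iff.2 (Or.inl hx)
  have hexp : Complex.exp (Complex.log a + Complex.log b) =
      Complex.exp (Complex.log c + Complex.log d) := by
    rw [Complex.exp_add, Complex.exp_add, Complex.exp_log (ne ha), Complex.exp_log (ne hb),
      Complex.exp_log (ne hc), Complex.exp_log (ne hd), h]
  have hlog : Complex.log a + Complex.log b = Complex.log c + Complex.log d := by
    obtain ⟨n, hn⟩ := Complex.exp_eq_exp_iff_exists_int.1 hexp
    have him := congrArg Complex.im hn
    have h2 : ((n : ℂ) * (2 * (Real.pi : ℂ) * Complex.I)).im = n * (2 * Real.pi) := by simp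
    rw [Complex.add_im, Complex.add_im, Complex.add_im, h2] at him
    have a1 := abs_lt.1 (arg ha)
    have b1 := abs_lt.1 (arg hb)
    have c1 := abs_lt.1 (arg hc)
    have d1 := abs_lt.1 (arg hd)
    have hpi := Real.pi_pos
    -- All four arguments lie in (-π/2, π/2), so the two sums of arguments differ by less than 2π.
    have hn0 : n = 0 := by
      have h3 : (n : ℝ) < 1 := by
        by_contra! hcon
        nlinarith
      have h4 : (-1 : ℝ) < n := by
        by_contra! hcon
        nlinarith
      have h3' : n < 1 := by exact_mod_cast h3
      have h4' : -1 < n := by exact_mod_cast h4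
      omega
    rw [hn, hn0]
    simp
  rw [Complex.cpow_def_of_ne_zero (ne ha), Complex.cpow_def_of_ne_zero (ne hb),
    Complex.cpow_def_of_ne_zero (ne hc), Complex.cpow_def_of_ne_zero (ne hd), ← Complex.exp_add,
    ← Complex.exp_add, ← add_mul, ← add_mul, hlog]

theorem hasDerivAt_mul_add_one_cpow {a : ℂ} (ha : ‖a‖ < 1) (p : ℂ) {z : ℂ}
    (hz : z ∈ ball (0 : ℂ) 1) :
    HasDerivAt (fun z => (a * z + 1) ^ p) (p * a * (a * z + 1) ^ (p - 1)) z := by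
  have h : HasDerivAt (fun z : ℂ => a * z + 1) (a * 1) z :=
    ((hasDerivAt_id z).const_mul a).add_const 1
  convert h.cpow_const (c := p) (Or.inl (re_mul_add_one_pos ha hz)) using 1
  ring

/-! ### The adjoint formula under differentiation and change of weights -/

namespace WeightedHardy

variable {β β' : WeightSeq} {lam u : ℂ}

/-- On `H²(β)` composition with the automorphism, with its inverse, and multiplication by
`(1 - conj (lam u) z) ^ q` and `(1 + conj u z) ^ (-q)` are bounded and satisfy the adjoint formula
modulo compact operators. -/
def HasAdjointFormula (β : WeightSeq) (lam u q : ℂ) : Prop :=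
  ∃ C C' MG MF : WeightedHardy β →L[ℂ] WeightedHardy β,
    IsWeightedComposition (fun _ => 1) (diskAut lam u) C ∧
    IsWeightedComposition (fun _ => 1) (diskAut (starRingEnd ℂ lam) (-(lam * u))) C' ∧
    IsWeightedComposition (fun z => (-starRingEnd ℂ (lam * u) * z + 1) ^ q) id MG ∧
    IsWeightedComposition (fun z => (starRingEnd ℂ u * z + 1) ^ (-q)) id MF ∧
    IsCompactOperator (ContinuousLinearMap.adjoint C -
      (ContinuousLinearMap.adjoint MG).comp (C'.comp MF))

/-- The shift of q by 2 comes from the chain rule: each composition operator, after differentiation,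
acquires the square of a linear factor, and these squares are absorbed into G and into 1/H. -/
theorem HasOrder.hasAdjointFormula_of_derivWeight {t : ℝ} (h : HasOrder β t) (hlam : ‖lam‖ = 1)
    (hu : ‖u‖ < 1) {q : ℂ} (ih : HasAdjointFormula (derivWeight β) lam u (q - 2)) :
    HasAdjointFormula β lam u q := by
  obtain ⟨C, C', MG, MF, hC, hC', hMG, hMF, hK⟩ := ih
  have ha := norm_neg_conj_mul_lt_one hlam hu
  have hb := norm_conj_lt_one hu
  have hl := conj_mul_self_of_norm_eq_one hlam
  have he := one_sub_conj_mul_ne_zero hu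
  set a := -starRingEnd ℂ (lam * u) with ha_def
  set b := starRingEnd ℂ u with hb_def
  set e := 1 - b * u with he_def
  set φ := diskAut lam u with hφ_def
  set ψ := diskAut (starRingEnd ℂ lam) (-(lam * u)) with hψ_def
  have hφ : ∀ z ∈ ball (0 : ℂ) 1, φ z ∈ ball (0 : ℂ) 1 := fun z hz =>
    diskAut_mem_ball hlam hu hz
  have hψ : ∀ z ∈ ball (0 : ℂ) 1, ψ z ∈ ball (0 : ℂ) 1 := fun z hz =>
    diskAut_mem_ball (norm_conj_eq_one hlam) (norm_neg_mul_lt_one hlam hu) hz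
  have hne : ∀ {x z : ℂ}, ‖x‖ < 1 → z ∈ ball (0 : ℂ) 1 → x * z + 1 ≠ 0 :=
    fun hx hz => mul_add_one_ne_zero hx hz
  have hφm : ∀ z ∈ ball (0 : ℂ) 1, (b * z + 1) * (a * φ z + 1) = e := fun z hz =>
    mul_diskAut_add_one hlam hu hz
  have hψm : ∀ z ∈ ball (0 : ℂ) 1, (a * z + 1) * (b * ψ z + 1) = e := fun z hz =>
    mul_diskAut_conj_add_one hlam hu hz
  have hφ' : ∀ z ∈ ball (0 : ℂ) 1, HasDerivAt φ (lam * e / (b * z + 1) ^ 2) z := fun z hz =>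
    hasDerivAt_diskAut hu hz
  have hψ' : ∀ z ∈ ball (0 : ℂ) 1,
      HasDerivAt ψ (starRingEnd ℂ lam * e / (a * z + 1) ^ 2) z := fun z hz => by
    have := hasDerivAt_diskAut (lam := starRingEnd ℂ lam) (norm_neg_mul_lt_one hlam hu) hz
    have h1 : 1 - starRingEnd ℂ (-(lam * u)) * -(lam * u) = e := by
      rw [map_neg, map_mul]
      linear_combination (-b * u) * hl
    rwa [h1, map_neg] at this
  have h' := h.hasOrder_derivWeight
  obtain ⟨D, hD⟩ := exists_derivative β
  obtain ⟨J, hJ, hJc, hJc'⟩ := h.exists_inclusion_derivWeight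
  obtain ⟨X, hX⟩ := h'.exists_mul_cpow ha q
  obtain ⟨Y, hY⟩ := h'.exists_mul_cpow hb (-q)
  obtain ⟨M₁, hM₁⟩ := h'.exists_mul_cpow ha 2
  obtain ⟨M₂, hM₂⟩ := h'.exists_mul_cpow hb 2
  obtain ⟨MGb, hMGb⟩ := h.exists_mul_cpow ha q
  obtain ⟨MFb, hMFb⟩ := h.exists_mul_cpow hb (-q)
  obtain ⟨N₁, hN₁⟩ := h.exists_mul_cpow ha (q - 1)
  obtain ⟨N₂, hN₂⟩ := h.exists_mul_cpow hb (-q - 1)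
  have hM₁' := hM₁.const_smul h' (lam / e)
  have hM₂' := hM₂.const_smul h' (starRingEnd ℂ lam / e)
  have hR : IsWeightedComposition (fun z => lam * e / (b * z + 1) ^ 2) φ
      -- The derivative φ' is written as a function of φ(z), namely (λ/e)(aφ(z) + 1)², so the
      -- multiplication can act before the composition.
      (C.comp ((lam / e) • M₁)) := (hC.comp hM₁' hφ).congr (fun z hz => by
    have h1 := hne hb hz
    have h2 := hφm z hz
    have h3 : a * φ z + 1 = e / (b * z + 1) := by
      rw [eq_div_iff h1, mul_comm]
      exact h2
    rw [Complex.cpow_ofNat, h3]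
    field_simp) fun _ _ => rfl
  have hR' : IsWeightedComposition (fun z => starRingEnd ℂ lam * e / (a * z + 1) ^ 2) ψ
      (C'.comp ((starRingEnd ℂ lam / e) • M₂)) := (hC'.comp hM₂' hψ).congr (fun z hz => by
    have h1 := hne ha hz
    have h2 := hψm z hz
    have h3 : b * ψ z + 1 = e / (a * z + 1) := by
      rw [eq_div_iff h1, mul_comm]
      exact h2
    rw [Complex.cpow_ofNat, h3]
    field_simp) fun _ _ => rfl
  obtain ⟨Cb, hCb⟩ := h.exists_composition_of_derivWeight hR hφ hφ'
  obtain ⟨Cb', hCb'⟩ := h.exists_composition_of_derivWeight hR' hψ hψ'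
  refine ⟨Cb, Cb', MGb, MFb, hCb, hCb', hMGb, hMFb, ?_⟩
  have k₁ : IsCompactOperator (ContinuousLinearMap.adjoint (J.comp ((q * a) • N₁))) := by
    rw [ContinuousLinearMap.adjoint_comp]
    exact hJc'.clm_comp (ContinuousLinearMap.adjoint ((q * a) • N₁))
  have k₂ : IsCompactOperator (J.comp ((-q * b) • N₂)) := hJc.comp_clm ((-q * b) • N₂)
  have hmem : ∀ z ∈ ball (0 : ℂ) 1, id z ∈ ball (0 : ℂ) 1 := fun _ h => h
  -- The scalar c is the one carried by `M₁`, and c' = λe cancels the scalar conj(λ)/e carried by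
  -- `M₂`. Their compatibility uses |λ| = 1 and that e = 1 - |u|² is real.
  refine isCompactOperator_adjoint_sub_of_intertwining
    (isCompactOperator_id_sub_adjoint_comp_derivative hD) k₁ k₂
    (c := lam / e) (c' := lam * e) (C := C) (C' := C') (MG := MG) (MF := MF)
    (M₁ := (lam / e) • M₁) (M₂ := (starRingEnd ℂ lam / e) • M₂) (X := X) (Y := Y) ?_ ?_ ?_ ?_ ?_
    ?_ ?_ hK
  · have hce : starRingEnd ℂ e = e := by
      rw [he_def, hb_def, map_sub, map_one, map_mul, Complex.conj_conj, mul_comm]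
    rw [map_div₀, hce]
    field_simp
    exact hl
  · exact h.derivative_comp_composition hD hCb hR hφ hφ'
  · exact h.derivative_comp_composition hD hCb' hR' hψ hψ'
  · exact h.derivative_comp_multiplication hD hMGb (hN₁.const_smul h (q * a)) hX hJ
      fun z hz => hasDerivAt_mul_add_one_cpow ha q hz
  · exact h.derivative_comp_multiplication hD hMFb (hN₂.const_smul h (-q * b)) hY hJ
      fun z hz => hasDerivAt_mul_add_one_cpow hb (-q) hz
  · refine (hMG.comp hM₁' hmem).unique h' (hX.const_smul h' (lam / e)) (fun z hz => ?_)
      fun _ _ => rfl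
    have h1 : (a * z + 1) ^ q = (a * z + 1) ^ (q - 2) * (a * z + 1) ^ (2 : ℂ) := by
      rw [← Complex.cpow_add _ _ (hne ha hz), sub_add_cancel]
    simp only [id, h1]
    ring
  · refine hMF.unique h' ((hM₂'.comp hY hmem).const_smul h' (lam * e)) (fun z hz => ?_)
      fun _ _ => rfl
    have h1 : (b * z + 1) ^ (-(q - 2)) = (b * z + 1) ^ (2 : ℂ) * (b * z + 1) ^ (-q) := by
      rw [← Complex.cpow_add _ _ (hne hb hz)]
      congr 1
      ring
    simp only [id, h1]
    field_simp
    rw [mul_assoc, mul_comm lam, hl, mul_one]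

/-- The identity on power series is an isomorphism between the two spaces, and it is diagonal with
weight ratio tending to c > 0. Its adjoint is therefore c² times its inverse up to a compact
diagonal operator. -/
theorem HasOrder.hasAdjointFormula_of_hasOrder {t : ℝ} (h : HasOrder β t) (h' : HasOrder β' t)
    {q : ℂ} (hβ : HasAdjointFormula β' lam u q)  : HasAdjointFormula β lam u q := by
  obtain ⟨C, C', MG, MF, hC, hC', hMG, hMF, hK⟩ := hβ
  obtain ⟨c, hc, hlim⟩ := h.tendsto_div h'
  have hlim' : Tendsto (fun n => (β n : ℝ) / β' n) atTop (𝓝 c⁻¹) :=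
    (hlim.inv₀ hc.ne').congr fun n => inv_div _ _
  have ex : ∀ {γ γ' : WeightSeq} {d : ℝ}, Tendsto (fun n => (γ' n : ℝ) / γ n) atTop (𝓝 d) →
      ∃ W : WeightedHardy γ →L[ℂ] WeightedHardy γ', ∀ f n, (W f).coeff n = f.coeff n := by
    intro γ γ' d hd
    obtain ⟨K, hK⟩ := hd.bddAbove_range
    obtain ⟨W, hW, -⟩ := exists_diagonal (β := γ) (β' := γ') (c := fun _ => 1) (C := K)
      (fun n => by
        rw [norm_one, mul_one, ← div_le_iff₀ (γ n).2]
        exact hK (Set.mem_range_self n))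
    exact ⟨W, fun f n => by rw [hW, one_mul]⟩
  have adj : ∀ {γ γ' : WeightSeq} {d : ℝ}, 0 < d →
      Tendsto (fun n => (γ' n : ℝ) / γ n) atTop (𝓝 d) →
      ∀ {W : WeightedHardy γ →L[ℂ] WeightedHardy γ'} {V : WeightedHardy γ' →L[ℂ] WeightedHardy γ},
      (∀ f n, (W f).coeff n = f.coeff n) → (∀ f n, (V f).coeff n = f.coeff n) →
      IsCompactOperator (ContinuousLinearMap.adjoint W - ((d ^ 2 : ℝ) : ℂ) • V) := by
    intro γ γ' d hd0 hd W V hW hV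
    refine isCompactOperator_of_diagonal
      (c := fun n => ((((γ' n : ℝ) / γ n) ^ 2 - d ^ 2 : ℝ) : ℂ)) (fun f n => ?_) ?_
    · rw [sub_apply, coeff_sub, adjoint_diagonal (c := fun _ => 1) (fun f n => by rw [hW, one_mul]),
        smul_apply, coeff_smul, hV]
      push_cast
      rw [map_one]
      ring
    · have h1 : Tendsto (fun n => ((γ' n : ℝ) / γ n) ^ 2 - d ^ 2) atTop (𝓝 0) := by
        have := (hd.pow 2).sub_const (d ^ 2)
        rwa [sub_self] at this
      have h2 := h1.norm.mul ((hd.inv₀ hd0.ne'))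
      rw [norm_zero, zero_mul] at h2
      refine h2.congr fun n => ?_
      rw [Complex.norm_real, inv_div]
  obtain ⟨W, hW⟩ := ex hlim
  obtain ⟨V, hV⟩ := ex hlim'
  have hWV : W.comp V = ContinuousLinearMap.id ℂ _ := ext_coeff fun f n => by
    rw [ContinuousLinearMap.comp_apply, hW, hV]; rfl
  have tr : ∀ {w φ : ℂ → ℂ} {T : WeightedHardy β' →L[ℂ] WeightedHardy β'},
      IsWeightedComposition w φ T → IsWeightedComposition w φ (V.comp (T.comp W)) := by
    intro w φ T hT f z hz
    rw [ContinuousLinearMap.comp_apply, isWeightedComposition_of_coeff_eq hV _ z hz, one_mul, id,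
      ContinuousLinearMap.comp_apply, hT _ z hz]
    congr 1
    exact tsum_congr fun n => by rw [hW]
  refine ⟨V.comp (C.comp W), V.comp (C'.comp W), V.comp (MG.comp W), V.comp (MF.comp W), tr hC,
    tr hC', tr hMG, tr hMF, ?_⟩
  refine isCompactOperator_adjoint_sub_of_similarity hWV (c := ((c ^ 2 : ℝ) : ℂ))
    (c' := ((c⁻¹ ^ 2 : ℝ) : ℂ)) ?_ (adj hc hlim hW hV) (adj (inv_pos.2 hc) hlim' hV hW) hK
  rw [← Complex.ofReal_mul, ← mul_pow, mul_inv_cancel₀ hc.ne', one_pow, Complex.ofReal_one]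

end WeightedHardy

/-! ### The model spaces with kernel (1 - conj w z)^(-s) -/

/-- The Taylor coefficients of `(1 - z) ^ (-s)`. -/
def negBinomialCoeff (s : ℝ) (n : ℕ) : ℝ := (∏ j ∈ Finset.range n, (s + j)) / n.factorial

theorem negBinomialCoeff_pos {s : ℝ} (hs : 0 < s) (n : ℕ) : 0 < negBinomialCoeff s n :=
  div_pos (Finset.prod_pos fun j _ => by positivity) (by positivity)

theorem hasSum_negBinomialCoeff (s : ℝ) {x : ℂ} (hx : ‖x‖ < 1) :
    HasSum (fun n => (negBinomialCoeff s n : ℂ) * x ^ n) ((1 - x) ^ (-(s : ℂ))) := by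
  have h := (Complex.one_div_one_sub_cpow_hasFPowerSeriesOnBall_zero (s : ℂ)).hasSum (y := x)
    (by rw [← ENNReal.ofReal_one, Metric.eball_ofReal]; simpa using hx)
  simp only [FormalMultilinearSeries.ofScalars_apply_eq, zero_add, smul_eq_mul, one_div,
    ← Complex.cpow_neg] at h
  refine h.congr_fun ?_
  intro n
  congr 1
  have h1 := Ring.factorial_nsmul_multichoose_eq_ascPochhammer (s : ℂ) n
  have h2 : ∏ j ∈ Finset.range n, ((s : ℂ) + j) = (ascPochhammer ℕ n).smeval (s : ℂ) := by
    rw [Polynomial.ascPochhammer_smeval_eq_eval]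
    clear h1
    induction n with
    | zero => simp
    | succ n ih => rw [Finset.prod_range_succ, ascPochhammer_succ_eval, ih]
  rw [Ring.choose, show (s : ℂ) + n - 1 - n + 1 = s by ring, negBinomialCoeff]
  push_cast
  rw [h2, ← h1, nsmul_eq_mul, mul_div_cancel_left₀]
  exact_mod_cast n.factorial_ne_zero

/-- The weights of the space with reproducing kernel `(1 - conj w z) ^ (-s)`. -/
def negBinomialWeight {s : ℝ} (hs : 0 < s) : WeightSeq := fun n =>
  ⟨√(negBinomialCoeff s n)⁻¹, Real.sqrt_pos.2 (inv_pos.2 (negBinomialCoeff_pos hs n))⟩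

theorem negBinomialWeight_sq {s : ℝ} (hs : 0 < s) (n : ℕ) :
    (negBinomialWeight hs n : ℝ) ^ 2 = (negBinomialCoeff s n)⁻¹ :=
  Real.sq_sqrt (inv_pos.2 (negBinomialCoeff_pos hs n)).le

namespace WeightedHardy

/-- The square of β(n)/n^((1-s)/2) is Euler's n-th approximation to Γ(s) times the correction 1 +
s/n, since that approximation has one more factor s + n in its denominator. -/
theorem hasOrder_negBinomialWeight {s : ℝ} (hs : 0 < s) :
    HasOrder (negBinomialWeight hs) ((1 - s) / 2) := by
  refine ⟨√(Real.Gamma s), Real.sqrt_pos.2 (Real.Gamma_pos_of_pos hs), ?_⟩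
  have h1 : Tendsto (fun n : ℕ => 1 + s / (n : ℝ)) atTop (𝓝 (1 + 0)) :=
    (tendsto_const_div_atTop_nhds_zero_nat s).const_add 1
  have h2 := ((Real.GammaSeq_tendsto_Gamma s).mul h1).sqrt
  rw [add_zero, mul_one] at h2
  refine h2.congr' ?_
  filter_upwards [eventually_ge_atTop 1] with n hn
  have hn1 : (0 : ℝ) < n := by exact_mod_cast hn
  have hp : 0 < ∏ j ∈ Finset.range n, (s + (j : ℝ)) :=
    Finset.prod_pos fun j _ => by positivity
  have h3 : (n : ℝ) ^ ((1 - s) / 2) = √((n : ℝ) ^ (1 - s)) := by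
    rw [Real.sqrt_eq_rpow, ← Real.rpow_mul hn1.le]
    congr 1
    ring
  rw [h3]
  change _ = √(negBinomialCoeff s n)⁻¹ / _
  rw [← Real.sqrt_div (inv_pos.2 (negBinomialCoeff_pos hs n)).le]
  congr 1
  rw [Real.GammaSeq, Finset.prod_range_succ, negBinomialCoeff, Real.rpow_sub hn1, Real.rpow_one]
  have : (0 : ℝ) < (n : ℝ) ^ s := by positivity
  field_simp
  ring

variable {s : ℝ} {hs : 0 < s}

theorem exists_negBinomial_kernel (hs : 0 < s) : ∃ K : ℂ → WeightedHardy (negBinomialWeight hs),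
    (∀ w ∈ ball (0 : ℂ) 1, ∀ f, inner ℂ (K w) f = f.eval w) ∧
    ∀ w ∈ ball (0 : ℂ) 1, ∀ z ∈ ball (0 : ℂ) 1,
      (K w).eval z = (1 - starRingEnd ℂ w * z) ^ (-(s : ℂ)) := by
  have ex : ∀ w : ℂ, ∃ k : WeightedHardy (negBinomialWeight hs), w ∈ ball (0 : ℂ) 1 →
      (∀ f, inner ℂ k f = f.eval w) ∧ ∀ z ∈ ball (0 : ℂ) 1,
        k.eval z = (1 - starRingEnd ℂ w * z) ^ (-(s : ℂ)) := by
    intro w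
    by_cases hw : w ∈ ball (0 : ℂ) 1
    · obtain ⟨k, hk, hk'⟩ := (hasOrder_negBinomialWeight hs).exists_kernel hw
      refine ⟨k, fun _ => ⟨hk', fun z hz => ?_⟩⟩
      have hw1 : ‖w‖ < 1 := by simpa using hw
      have hz1 : ‖z‖ < 1 := by simpa using hz
      have hwz : ‖starRingEnd ℂ w * z‖ < 1 := by
        rw [norm_mul, Complex.norm_conj]
        nlinarith [norm_nonneg w, norm_nonneg z]
      refine ((hasOrder_negBinomialWeight hs).hasSum_eval k hz).unique
        ((hasSum_negBinomialCoeff s hwz).congr_fun ?_)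
      intro n
      rw [hk, ← Complex.ofReal_pow, negBinomialWeight_sq, mul_pow]
      push_cast
      rw [div_inv_eq_mul]
      ring
    · exact ⟨0, fun h => absurd h hw⟩
  choose K hK using ex
  exact ⟨K, fun w hw => (hK w hw).1, fun w hw => (hK w hw).2⟩

/-- A vector orthogonal to every kernel vanishes at every point of the disk. -/
theorem HasOrder.dense_span_kernel {β : WeightSeq} {t : ℝ} (h : HasOrder β t)
    {K : ℂ → WeightedHardy β} (hK : ∀ w ∈ ball (0 : ℂ) 1, ∀ f, inner ℂ (K w) f = f.eval w) :
    Dense (Submodule.span ℂ (K '' ball (0 : ℂ) 1) : Set (WeightedHardy β)) := by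
  rw [Submodule.dense_iff_topologicalClosure_eq_top, Submodule.topologicalClosure_eq_top_iff,
    Submodule.eq_bot_iff]
  intro f hf
  refine h.ext_eval fun z hz => ?_
  rw [← hK z hz, ← hK z hz, inner_zero_right]
  exact Submodule.inner_right_of_mem_orthogonal
    (Submodule.subset_span (Set.mem_image_of_mem K hz)) hf

end WeightedHardy

/-- Two families whose Gram matrices are proportional are related by a bounded operator, if the
first one is total. -/
theorem exists_clm_of_inner_eq {ι E F : Type*} [NormedAddCommGroup E] [InnerProductSpace ℂ E]
    [NormedAddCommGroup F] [InnerProductSpace ℂ F] [CompleteSpace F] {K : ι → E} {K' : ι → F}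
    (hK : Dense (Submodule.span ℂ (Set.range K) : Set E)) {r : ℝ} (hr : 0 ≤ r)
    (h : ∀ i j, (inner ℂ (K' i) (K' j) : ℂ) = (r : ℂ) * inner ℂ (K i) (K j)) :
    ∃ V : E →L[ℂ] F, ∀ i, V (K i) = K' i := by
  set L := Finsupp.linearCombination ℂ K
  set L' := Finsupp.linearCombination ℂ K'
  have hin : ∀ c, (inner ℂ (L' c) (L' c) : ℂ) = (r : ℂ) * inner ℂ (L c) (L c) := by
    intro c
    simp only [L, L', Finsupp.linearCombination_apply, Finsupp.sum, sum_inner, inner_sum,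
      Finset.mul_sum, inner_smul_left, inner_smul_right, h]
    refine Finset.sum_congr rfl fun i _ => Finset.sum_congr rfl fun j _ => ?_
    ring
  -- This bound also gives well-definedness: a combination that vanishes in E vanishes in F.
  have hbound : ∀ c, ‖L' c‖ ≤ √r * ‖L c‖ := by
    intro c
    have h2 : ‖L' c‖ ^ 2 = r * ‖L c‖ ^ 2 := by
      rw [← inner_self_eq_norm_sq (𝕜 := ℂ), ← inner_self_eq_norm_sq (𝕜 := ℂ), hin]
      exact Complex.re_ofReal_mul _ _
    refine le_of_sq_le_sq ?_ (by positivity)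
    rw [mul_pow, Real.sq_sqrt hr, h2]
  have hdense : DenseRange L := by
    rw [DenseRange, ← LinearMap.coe_range, Finsupp.range_linearCombination]
    exact hK
  refine ⟨L'.extendOfNorm L, fun i => ?_⟩
  have := LinearMap.extendOfNorm_eq hdense ⟨_, hbound⟩ (Finsupp.single i 1)
  simpa [L, L'] using this

namespace WeightedHardy

variable {s : ℝ} {lam u : ℂ}

theorem one_sub_mem_re_pos {w z : ℂ} (hw : w ∈ ball (0 : ℂ) 1) (hz : z ∈ ball (0 : ℂ) 1) :
    0 < (1 - starRingEnd ℂ w * z).re := by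
  have hw1 : ‖-starRingEnd ℂ w‖ < 1 := by simpa using hw
  have := re_mul_add_one_pos hw1 hz
  rwa [neg_mul, neg_add_eq_sub] at this

theorem kernel_diskAut_cpow (hlam : ‖lam‖ = 1) (hu : ‖u‖ < 1) {w z : ℂ}
    (hw : w ∈ ball (0 : ℂ) 1) (hz : z ∈ ball (0 : ℂ) 1) (p : ℂ) :
    (1 - starRingEnd ℂ w * z) ^ p * (-starRingEnd ℂ (lam * u) * diskAut lam u z + 1) ^ p =
      (u * starRingEnd ℂ w + 1) ^ p *
        (1 - starRingEnd ℂ (diskAut lam u w) * diskAut lam u z) ^ p :=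
  mul_cpow_eq_mul_cpow_of_re_pos (one_sub_mem_re_pos hw hz)
    (re_mul_add_one_pos (norm_neg_conj_mul_lt_one hlam hu) (diskAut_mem_ball hlam hu hz))
    (re_mul_add_one_pos hu (by simpa using hw))
    (one_sub_mem_re_pos (diskAut_mem_ball hlam hu hw) (diskAut_mem_ball hlam hu hz))
    (kernel_diskAut hlam hu hw hz) p

theorem one_sub_conj_mul_eq_ofReal (u : ℂ) :
    1 - starRingEnd ℂ u * u = ((1 - ‖u‖ ^ 2 : ℝ) : ℂ) := by
  rw [Complex.conj_mul']
  push_cast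
  rfl

theorem one_sub_norm_sq_pos (hu : ‖u‖ < 1) : 0 < 1 - ‖u‖ ^ 2 := by
  nlinarith [norm_nonneg u]

theorem mul_diskAut_add_one_cpow (hlam : ‖lam‖ = 1) (hu : ‖u‖ < 1) {z : ℂ}
    (hz : z ∈ ball (0 : ℂ) 1) (p : ℂ) :
    (starRingEnd ℂ u * z + 1) ^ p * (-starRingEnd ℂ (lam * u) * diskAut lam u z + 1) ^ p =
      (1 - starRingEnd ℂ u * u) ^ p := by
  rw [mul_cpow_eq_mul_cpow_of_re_pos (re_mul_add_one_pos (norm_conj_lt_one hu) hz)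
    (re_mul_add_one_pos (norm_neg_conj_mul_lt_one hlam hu) (diskAut_mem_ball hlam hu hz))
    (c := 1 - starRingEnd ℂ u * u) (d := 1) ?_ (by simp) ?_ p, Complex.one_cpow, mul_one]
  · rw [one_sub_conj_mul_eq_ofReal, Complex.ofReal_re]
    exact one_sub_norm_sq_pos hu
  · rw [mul_one, mul_diskAut_add_one hlam hu hz]

theorem conj_cpow_of_re_pos {x : ℂ} (hx : 0 < x.re) (p : ℝ) :
    starRingEnd ℂ (x ^ (p : ℂ)) = starRingEnd ℂ x ^ (p : ℂ) := by
  rw [Complex.conj_cpow, Complex.conj_ofReal]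
  intro h
  have := Complex.abs_arg_lt_pi_div_two_iff.2 (Or.inl hx)
  rw [h, abs_of_pos Real.pi_pos] at this
  linarith [Real.pi_pos]

theorem cpow_ne_zero_of_re_pos {x : ℂ} (hx : 0 < x.re) (p : ℂ) : x ^ p ≠ 0 := by
  have hx0 : x ≠ 0 := fun h => by simp [h] at hx
  rw [Complex.cpow_def_of_ne_zero hx0]
  exact Complex.exp_ne_zero _

/-- By the covariance of the kernel, sending K_w to conj(g(w)) K_{φ(w)} with g = (conj u z + 1)^(-s)
multiplies all inner products by (1 - |u|²)^(-s), hence defines a bounded operator. Its adjoint is f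
↦ g · (f ∘ φ), and multiplication by 1/g leaves C_φ. -/
theorem exists_composition_negBinomial (hs : 0 < s) (hlam : ‖lam‖ = 1) (hu : ‖u‖ < 1) :
    ∃ C : WeightedHardy (negBinomialWeight hs) →L[ℂ] WeightedHardy (negBinomialWeight hs),
      IsWeightedComposition (fun _ => 1) (diskAut lam u) C := by
  have hord := hasOrder_negBinomialWeight hs
  obtain ⟨K, hK, hKe⟩ := exists_negBinomial_kernel hs
  have hφ : ∀ z ∈ ball (0 : ℂ) 1, diskAut lam u z ∈ ball (0 : ℂ) 1 := fun z hz =>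
    diskAut_mem_ball hlam hu hz
  have hb := norm_conj_lt_one hu
  let g : ℂ → ℂ := fun w => (starRingEnd ℂ u * w + 1) ^ (-(s : ℂ))
  have hdense := hord.dense_span_kernel hK
  rw [Set.image_eq_range] at hdense
  obtain ⟨V, hV⟩ := exists_clm_of_inner_eq (K := fun w : ball (0 : ℂ) 1 => K w)
    (K' := fun w : ball (0 : ℂ) 1 => starRingEnd ℂ (g w) • K (diskAut lam u w)) hdense
    (r := (1 - ‖u‖ ^ 2) ^ (-s)) (Real.rpow_nonneg (one_sub_norm_sq_pos hu).le _) (by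
      rintro ⟨w, hw⟩ ⟨v, hv⟩
      have ha := cpow_ne_zero_of_re_pos (re_mul_add_one_pos (norm_neg_conj_mul_lt_one hlam hu)
        (hφ w hw)) (-(s : ℂ))
      have h1 := kernel_diskAut_cpow hlam hu hv hw (-(s : ℂ))
      have h2 := mul_diskAut_add_one_cpow hlam hu hw (-(s : ℂ))
      have h3 : starRingEnd ℂ (g v) = (u * starRingEnd ℂ v + 1) ^ (-(s : ℂ)) := by
        have := conj_cpow_of_re_pos (re_mul_add_one_pos hb hv) (-s)
        push_cast at this
        simpa using this
      rw [Complex.ofReal_cpow (one_sub_norm_sq_pos hu).le, ← one_sub_conj_mul_eq_ofReal,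
        Complex.ofReal_neg, ← h2]
      simp only [inner_smul_left, inner_smul_right, Complex.conj_conj, h3]
      rw [hK _ (hφ w hw), hK w hw, hKe _ (hφ v hv) _ (hφ w hw), hKe v hv w hw]
      simp only [g]
      linear_combination (-(starRingEnd ℂ u * w + 1) ^ (-(s : ℂ))) * h1)
  have hVa : IsWeightedComposition g (diskAut lam u) (ContinuousLinearMap.adjoint V) := by
    intro f z hz
    have h1 : V (K z) = starRingEnd ℂ (g z) • K (diskAut lam u z) := hV ⟨z, hz⟩
    rw [← hK z hz, ContinuousLinearMap.adjoint_inner_right, h1, inner_smul_left, Complex.conj_conj,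
      hK _ (hφ z hz)]
  obtain ⟨M, hM⟩ := hord.exists_mul_cpow hb s
  refine ⟨M.comp (ContinuousLinearMap.adjoint V), (hM.comp hVa fun _ h => h).congr
    (fun z hz => ?_) fun _ _ => rfl⟩
  have := cpow_ne_zero_of_re_pos (re_mul_add_one_pos hb hz) (s : ℂ)
  simp only [g, id, Complex.cpow_neg]
  exact mul_inv_cancel₀ this

/-- Here the difference is zero, not merely compact: both operators send K_w to K_{φ(w)}. -/
theorem hasAdjointFormula_negBinomial (hs : 0 < s) (hlam : ‖lam‖ = 1) (hu : ‖u‖ < 1) :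
    HasAdjointFormula (negBinomialWeight hs) lam u (-(s : ℂ)) := by
  have hord := hasOrder_negBinomialWeight hs
  have ha := norm_neg_conj_mul_lt_one hlam hu
  have hb := norm_conj_lt_one hu
  have hφ : ∀ z ∈ ball (0 : ℂ) 1, diskAut lam u z ∈ ball (0 : ℂ) 1 := fun z hz =>
    diskAut_mem_ball hlam hu hz
  obtain ⟨K, hK, hKe⟩ := exists_negBinomial_kernel hs
  obtain ⟨C, hC⟩ := exists_composition_negBinomial hs hlam hu
  obtain ⟨C', hC'⟩ := exists_composition_negBinomial hs (norm_conj_eq_one hlam)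
    (norm_neg_mul_lt_one hlam hu)
  obtain ⟨MG, hMG⟩ := hord.exists_mul_cpow ha (-(s : ℂ))
  obtain ⟨MF, hMF⟩ := hord.exists_mul_cpow hb (-(-(s : ℂ)))
  refine ⟨C, C', MG, MF, hC, hC', hMG, hMF, ?_⟩
  have key : ContinuousLinearMap.adjoint C =
      (ContinuousLinearMap.adjoint MG).comp (C'.comp MF) := by
    refine ContinuousLinearMap.ext_on (hord.dense_span_kernel hK) ?_
    rintro _ ⟨w, hw, rfl⟩
    have hφw := hφ w hw
    set G := (-starRingEnd ℂ (lam * u) * diskAut lam u w + 1) ^ (-(s : ℂ)) with hG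
    have hG0 : starRingEnd ℂ G ≠ 0 := by
      rw [Ne, map_eq_zero]
      exact cpow_ne_zero_of_re_pos (re_mul_add_one_pos ha hφw) _
    have h1 : ContinuousLinearMap.adjoint C (K w) = K (diskAut lam u w) :=
      ext_inner_right ℂ fun f => by
        rw [ContinuousLinearMap.adjoint_inner_left, hK w hw, hC f w hw, one_mul, hK _ hφw]
    have h2 : ContinuousLinearMap.adjoint MG (K (diskAut lam u w)) =
        starRingEnd ℂ G • K (diskAut lam u w) :=
      ext_inner_right ℂ fun f => by
        rw [ContinuousLinearMap.adjoint_inner_left, hK _ hφw, hMG f _ hφw, inner_smul_left,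
          Complex.conj_conj, hK _ hφw]
        rfl
    -- With y = φ⁻¹(z), this combines kernel covariance at (w, y) with the constancy of the product
    -- of the two linear factors, used once at y and once, conjugated, at w.
    have h3 : C' (MF (K w)) = (starRingEnd ℂ G)⁻¹ • K (diskAut lam u w) := by
      refine hord.ext_eval fun z hz => ?_
      set y := diskAut (starRingEnd ℂ lam) (-(lam * u)) z with hy_def
      have hy : y ∈ ball (0 : ℂ) 1 :=
        diskAut_mem_ball (norm_conj_eq_one hlam) (norm_neg_mul_lt_one hlam hu) hz
      have hyz : diskAut lam u y = z := diskAut_diskAut_conj hlam hu hz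
      rw [hC' _ z hz, one_mul, hMF _ y hy, hord.eval_smul _ _ hz, id, hKe w hw y hy,
        hKe _ hφw z hz]
      have i1 := kernel_diskAut_cpow hlam hu hw hy (-(s : ℂ))
      have i2 := mul_diskAut_add_one_cpow hlam hu hy (-(s : ℂ))
      have i3 := congrArg (starRingEnd ℂ) (mul_diskAut_add_one_cpow hlam hu hw (-(s : ℂ)))
      rw [hyz] at i1 i2
      have hu1 : 0 < (1 - starRingEnd ℂ u * u).re := by
        rw [one_sub_conj_mul_eq_ofReal, Complex.ofReal_re]
        exact one_sub_norm_sq_pos hu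
      have c1 := conj_cpow_of_re_pos (re_mul_add_one_pos hb hw) (-s)
      have c2 := conj_cpow_of_re_pos hu1 (-s)
      rw [Complex.ofReal_neg] at c1 c2
      rw [map_mul, ← hG, c1, c2] at i3
      simp only [map_add, map_sub, map_mul, map_one, Complex.conj_conj] at i3
      rw [mul_comm u (starRingEnd ℂ u), ← i2] at i3
      have n1 := cpow_ne_zero_of_re_pos (re_mul_add_one_pos hb hy) (-(s : ℂ))
      have n2 := cpow_ne_zero_of_re_pos (re_mul_add_one_pos ha hz) (-(s : ℂ))
      simp only [Complex.cpow_neg _ (-(s : ℂ))]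
      rw [inv_mul_eq_div, inv_mul_eq_div, div_eq_div_iff n1 hG0]
      refine mul_right_cancel₀ n2 ?_
      linear_combination (starRingEnd ℂ G) * i1 +
        (1 - starRingEnd ℂ (diskAut lam u w) * z) ^ (-(s : ℂ)) * i3
    rw [h1, ContinuousLinearMap.comp_apply, ContinuousLinearMap.comp_apply, h3, map_smul, h2,
      smul_smul, inv_mul_cancel₀ hG0, one_smul]
  rw [key, sub_self]
  exact isCompactOperator_zero

/-! ### Induction on the order and conclusion -/

theorem HasOrder.hasAdjointFormula {β : WeightSeq} {t : ℝ} (h : HasOrder β t) (hlam : ‖lam‖ = 1)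
    (hu : ‖u‖ < 1) : HasAdjointFormula β lam u ((2 * t - 1 : ℝ) : ℂ) := by
  -- After n differentiations the order t - n is below 1/2, which is where the model exponent s = 1
  -- - 2t is positive.
  obtain ⟨n, hn⟩ := exists_nat_gt (t - 1 / 2)
  induction n generalizing β t with
  | zero =>
    have hs : 0 < 1 - 2 * t := by
      rw [Nat.cast_zero] at hn
      linarith
    have hord := hasOrder_negBinomialWeight hs
    rw [show (1 - (1 - 2 * t)) / 2 = t by ring] at hord
    have := h.hasAdjointFormula_of_hasOrder hord (hasAdjointFormula_negBinomial hs hlam hu)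
    rwa [← Complex.ofReal_neg, neg_sub] at this
  | succ n ih =>
    refine h.hasAdjointFormula_of_derivWeight hlam hu ?_
    have := ih h.hasOrder_derivWeight (by
      push_cast at hn
      linarith)
    rwa [show ((2 * (t - 1) - 1 : ℝ) : ℂ) = ((2 * t - 1 : ℝ) : ℂ) - 2 by push_cast; ring] at this

/-- An operator is determined by the values of its outputs on the disk, so any operators with the
prescribed actions coincide with those already constructed. -/
theorem HasOrder.adjointFormulaModCompact {β : WeightSeq} {t : ℝ} (h : HasOrder β t)
    (hlam : ‖lam‖ = 1) (hu : ‖u‖ < 1) {G F : ℂ → ℂ}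
    (hG : ∀ z ∈ ball (0 : ℂ) 1,
      (-starRingEnd ℂ (lam * u) * z + 1) ^ ((2 * t - 1 : ℝ) : ℂ) = G z)
    (hF : ∀ z ∈ ball (0 : ℂ) 1, (starRingEnd ℂ u * z + 1) ^ (-((2 * t - 1 : ℝ) : ℂ)) = F z) :
    AdjointFormulaModCompact β (diskAut lam u) (diskAutInv lam u) G F := by
  obtain ⟨C, C', MG, MF, hC, hC', hMG, hMF, hK⟩ := h.hasAdjointFormula hlam hu
  have hC'' := hC'.congr (fun _ _ => rfl) fun z hz => (diskAutInv_eq hlam hu hz).symm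
  have hMG' := hMG.congr hG fun _ _ => rfl
  have hMF' := hMF.congr hF fun _ _ => rfl
  refine ⟨⟨C, fun f z hz => by rw [hC f z hz, one_mul]⟩,
    ⟨C', fun f z hz => by rw [hC'' f z hz, one_mul]⟩, ⟨MG, hMG'⟩, ⟨MF, hMF'⟩, ?_⟩
  intro Cφ Cψ NG NF hφ hψ hNG hNF
  have e₁ : Cφ = C := IsWeightedComposition.unique h (w := fun _ => 1) (φ := diskAut lam u)
    (fun f z hz => by rw [hφ f z hz, one_mul]) hC (fun _ _ => rfl) fun _ _ => rfl
  have e₂ : Cψ = C' := IsWeightedComposition.unique h (w := fun _ => 1) (φ := diskAutInv lam u)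
    (fun f z hz => by rw [hψ f z hz, one_mul]) hC'' (fun _ _ => rfl) fun _ _ => rfl
  have e₃ : NG = MG := IsWeightedComposition.unique h (w := G) (φ := id) hNG hMG'
    (fun _ _ => rfl) fun _ _ => rfl
  have e₄ : NF = MF := IsWeightedComposition.unique h (w := F) (φ := id) hNF hMF'
    (fun _ _ => rfl) fun _ _ => rfl
  rw [e₁, e₂, e₃, e₄]
  exact hK

theorem hasOrder_s2Weight : HasOrder s2Weight 1 := by
  refine ⟨1, one_pos, tendsto_const_nhds.congr' ?_⟩
  filter_upwards [eventually_ge_atTop 1] with n hn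
  have hn1 : (n : ℝ) ≠ 0 := by
    exact_mod_cast Nat.one_le_iff_ne_zero.1 hn
  have : (s2Weight n : ℝ) = n := if_neg (Nat.one_le_iff_ne_zero.1 hn)
  rw [this, Real.rpow_one, div_self hn1]

end WeightedHardy

end

theorem corollary3p4 (lam u : ℂ) (hlam : ‖lam‖ = 1) (hu : ‖u‖ < 1) :
    (∀ (β : WeightSeq) (t ℓ : ℝ), 0 < ℓ →
      Tendsto (fun n : ℕ => (β n : ℝ) / (n : ℝ) ^ t) atTop (𝓝 ℓ) →
      AdjointFormulaModCompact β (diskAut lam u) (diskAutInv lam u)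
        (fun z => (-starRingEnd ℂ (lam * u) * z + 1) ^ ((2 * t - 1 : ℝ) : ℂ))
        (fun z => 1 / (starRingEnd ℂ u * z + 1) ^ ((2 * t - 1 : ℝ) : ℂ))) ∧
    AdjointFormulaModCompact s2Weight (diskAut lam u) (diskAutInv lam u)
      (fun z => -starRingEnd ℂ (lam * u) * z + 1)
      (fun z => 1 / (starRingEnd ℂ u * z + 1)) := by
  refine ⟨fun β t ℓ hℓ hβ => ?_, ?_⟩
  · have h : WeightedHardy.HasOrder β t := ⟨ℓ, hℓ, hβ⟩
    exact h.adjointFormulaModCompact hlam hu (fun _ _ => rfl) fun z _ => by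
      rw [Complex.cpow_neg, one_div]
  · have h1 : ((2 * 1 - 1 : ℝ) : ℂ) = 1 := by norm_num
    refine WeightedHardy.hasOrder_s2Weight.adjointFormulaModCompact hlam hu (fun z _ => ?_)
      fun z _ => ?_
    · rw [h1, Complex.cpow_one]
    · rw [h1, Complex.cpow_neg, Complex.cpow_one, one_div]
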